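/- Let $(M,g)$ be a smooth spacetime of dimension $n\ge 3$ (a smooth manifold with a smooth Lorentzian metric of signature $(-,+,\dots,+)$), and let $u$ be a smooth unit timelike vector field on $M$, $g(u,u)=-1$. Put $h_{ab}=g_{ab}+u_au_b$ and $\theta=\nabla^a u_a$, and suppose that $u$ is shear-free and twist-free, i.e. $$h_a{}^c h_b{}^d\,\nabla_{(d}u_{c)}-\tfrac{\theta}{n-1}h_{ab}=0,\qquad h_a{}^c h_b{}^d\,\nabla_{[d}u_{c]}=0 .$$ Then: (i) $(M,g)$ is purely electric (PE) with respect to $u$: the magnetic part of the Weyl tensor $C_{abcd}$, $$(C_-)^{ab}{}_{cd}=2h^{ae}h^{bf}C_{efk[c}u_{d]}u^k+2u_ku^{[a}C^{b]kef}h_{ce}h_{df},$$ vanishes at every point of $M$. (ii) Call local coordinates $(t,x)=(t,x^1,\dots,x^{n-1})$ adapted to $u$ if $u=V^{-1}\partial_t$ with $V>0$, the hypersurfaces of constant $t$ are orthogonal to $u$, and any two points of the coordinate domain with the same $x$ are joined, inside the domain, by the segment of constant $x$ between them. Every point of $M$ has a neighbourhood with adapted coordinates, and in all adapted coordinates the line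 element reads $$ds^2=-V(t,x)^2\,dt^2+P(t,x)^2\,\xi_{\alpha\beta}(x)\,dx^\alpha dx^\beta,$$ where $V,P>0$ are smooth functions and $\xi_{\alpha\beta}(x)$ is a smooth, $t$-independent, positive definite symmetric matrix ($\alpha,\beta=1,\dots,n-1$). -/

import Mathlib

open scoped Manifold ContDiff Bundle
open Bundle

/-! ### Tensor calculus in one coordinate system

`G y` is the matrix of components `g_{ab}` of a metric at the coordinate point `y ∈ ℝⁿ`, and `U y`
is the list of components `u^a` of a vector field. -/

namespace Coord

variable {n : ℕ}

/-- The partial derivative `∂f/∂y^k`. -/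
noncomputable def pd (k : Fin n) (f : EuclideanSpace ℝ (Fin n) → ℝ)
    (y : EuclideanSpace ℝ (Fin n)) : ℝ :=
  fderiv ℝ f y (EuclideanSpace.single k (1 : ℝ))

section Curvature

variable (G : EuclideanSpace ℝ (Fin n) → Matrix (Fin n) (Fin n) ℝ)

/-- The Christoffel symbols `Γ^a_{bc}` of the Levi-Civita connection. -/
noncomputable def christoffel (a b c : Fin n) (y : EuclideanSpace ℝ (Fin n)) : ℝ :=
  (1 / 2) * ∑ e, (G y)⁻¹ a e *
    (pd b (fun z => G z e c) y + pd c (fun z => G z e b) y - pd e (fun z => G z b c) y)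

/-- The Riemann tensor `R^a_{bcd}`. -/
noncomputable def riemannUp (a b c d : Fin n) (y : EuclideanSpace ℝ (Fin n)) : ℝ :=
  pd c (christoffel G a d b) y - pd d (christoffel G a c b) y
    + ∑ e, (christoffel G a c e y * christoffel G e d b y
        - christoffel G a d e y * christoffel G e c b y)

/-- The Riemann tensor `R_{abcd}`. -/
noncomputable def riemann (a b c d : Fin n) (y : EuclideanSpace ℝ (Fin n)) : ℝ :=
  ∑ e, G y a e * riemannUp G e b c d y

/-- The Ricci tensor `R_{bd} = R^a_{bad}`. -/
noncomputable def ricci (b d : Fin n) (y : EuclideanSpace ℝ (Fin n)) : ℝ :=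
  ∑ a, riemannUp G a b a d y

/-- The scalar curvature `R = g^{bd} R_{bd}`. -/
noncomputable def scalarCurv (y : EuclideanSpace ℝ (Fin n)) : ℝ :=
  ∑ b, ∑ d, (G y)⁻¹ b d * ricci G b d y

/-- The Weyl tensor `C_{abcd}` (meaningful for `n ≥ 3`). -/
noncomputable def weyl (a b c d : Fin n) (y : EuclideanSpace ℝ (Fin n)) : ℝ :=
  riemann G a b c d y
    - (1 / ((n : ℝ) - 2)) *
      (G y a c * ricci G b d y - G y a d * ricci G b c y
        - G y b c * ricci G a d y + G y b d * ricci G a c y)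
    + scalarCurv G y / (((n : ℝ) - 1) * ((n : ℝ) - 2)) *
      (G y a c * G y b d - G y a d * G y b c)

/-- The Weyl tensor with raised indices, `C^{abcd}`. -/
noncomputable def weylUp (a b c d : Fin n) (y : EuclideanSpace ℝ (Fin n)) : ℝ :=
  ∑ a', ∑ b', ∑ c', ∑ d',
    (G y)⁻¹ a a' * (G y)⁻¹ b b' * (G y)⁻¹ c c' * (G y)⁻¹ d d' * weyl G a' b' c' d' y

end Curvature

section Observer

variable (G : EuclideanSpace ℝ (Fin n) → Matrix (Fin n) (Fin n) ℝ)
  (U : EuclideanSpace ℝ (Fin n) → Fin n → ℝ)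

/-- `u_a = g_{ab} u^b`. -/
noncomputable def lower (a : Fin n) (y : EuclideanSpace ℝ (Fin n)) : ℝ :=
  ∑ b, G y a b * U y b

/-- The `u`-orthogonal projector `h_{ab} = g_{ab} + u_a u_b`. -/
noncomputable def proj (a b : Fin n) (y : EuclideanSpace ℝ (Fin n)) : ℝ :=
  G y a b + lower G U a y * lower G U b y

/-- The projector `h^{ab} = g^{ab} + u^a u^b`. -/
noncomputable def projUp (a b : Fin n) (y : EuclideanSpace ℝ (Fin n)) : ℝ :=
  (G y)⁻¹ a b + U y a * U y b

/-- The projector `h_a^b = δ_a^b + u_a u^b`. -/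
noncomputable def projMix (a b : Fin n) (y : EuclideanSpace ℝ (Fin n)) : ℝ :=
  (if a = b then 1 else 0) + lower G U a y * U y b

/-- The covariant derivative `∇_b u_a`. -/
noncomputable def covDeriv (b a : Fin n) (y : EuclideanSpace ℝ (Fin n)) : ℝ :=
  pd b (lower G U a) y - ∑ c, christoffel G c b a y * lower G U c y

/-- The spatial part `h_a^c h_b^d ∇_d u_c` of the covariant derivative. -/
noncomputable def spatialDeriv (a b : Fin n) (y : EuclideanSpace ℝ (Fin n)) : ℝ :=
  ∑ c, ∑ d, projMix G U a c y * projMix G U b d y * covDeriv G U d c y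

/-- The expansion scalar `θ = ∇^a u_a`. -/
noncomputable def expansion (y : EuclideanSpace ℝ (Fin n)) : ℝ :=
  ∑ a, ∑ b, (G y)⁻¹ a b * covDeriv G U b a y

/-- The shear `σ_{ab} = h_a^c h_b^d ∇_{(d} u_{c)} - θ h_{ab} / (n - 1)`. -/
noncomputable def shear (a b : Fin n) (y : EuclideanSpace ℝ (Fin n)) : ℝ :=
  (spatialDeriv G U a b y + spatialDeriv G U b a y) / 2
    - expansion G U y / ((n : ℝ) - 1) * proj G U a b y

/-- The twist (vorticity) `ω_{ab} = h_a^c h_b^d ∇_{[d} u_{c]}`. -/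
noncomputable def twist (a b : Fin n) (y : EuclideanSpace ℝ (Fin n)) : ℝ :=
  (spatialDeriv G U a b y - spatialDeriv G U b a y) / 2

/-- The magnetic part of the Weyl tensor with respect to `u`,
`(C_-)^{ab}_{cd} = 2 h^{ae} h^{bf} C_{efk[c} u_{d]} u^k + 2 u_k u^{[a} C^{b]kef} h_{ce} h_{df}`. -/
noncomputable def weylMagnetic (a b c d : Fin n) (y : EuclideanSpace ℝ (Fin n)) : ℝ :=
  2 * (∑ e, ∑ f, ∑ k, projUp G U a e y * projUp G U b f y *
      ((weyl G e f k c y * lower G U d y - weyl G e f k d y * lower G U c y) / 2) * U y k)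
  + 2 * (∑ k, ∑ e, ∑ f, lower G U k y *
      ((U y a * weylUp G b k e f y - U y b * weylUp G a k e f y) / 2) *
      proj G U c e y * proj G U d f y)

end Observer

end Coord

/-! ### Spacetimes -/

/-- A smooth Lorentzian metric, of signature `(-, +, …, +)`, on a smooth manifold of dimension
`d + 1`. -/
structure LorentzMetric (d : ℕ) (M : Type*) [TopologicalSpace M]
    [ChartedSpace (EuclideanSpace ℝ (Fin (d + 1))) M] [IsManifold (𝓡 (d + 1)) ∞ M] where
  /-- The scalar product on each tangent space. -/
  val (p : M) : TangentSpace (𝓡 (d + 1)) p →L[ℝ] TangentSpace (𝓡 (d + 1)) p →L[ℝ] ℝ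
  symm (p : M) (v w : TangentSpace (𝓡 (d + 1)) p) : val p v w = val p w v
  /-- Every tangent space has an orthonormal basis with exactly one timelike member. -/
  signature (p : M) : ∃ e : Module.Basis (Fin (d + 1)) ℝ (TangentSpace (𝓡 (d + 1)) p),
    ∀ i j, val p (e i) (e j) = if i = j then (if i = 0 then -1 else 1) else 0
  contMDiff : ContMDiff (𝓡 (d + 1)) ((𝓡 (d + 1)).prod
      𝓘(ℝ, EuclideanSpace ℝ (Fin (d + 1)) →L[ℝ] EuclideanSpace ℝ (Fin (d + 1)) →L[ℝ] ℝ)) ∞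
    (fun p => TotalSpace.mk'
      (EuclideanSpace ℝ (Fin (d + 1)) →L[ℝ] EuclideanSpace ℝ (Fin (d + 1)) →L[ℝ] ℝ)
      (E := fun p : M =>
        TangentSpace (𝓡 (d + 1)) p →L[ℝ] TangentSpace (𝓡 (d + 1)) p →L[ℝ] ℝ) p (val p))

namespace LorentzMetric

variable {d : ℕ} {M : Type*} [TopologicalSpace M]
  [ChartedSpace (EuclideanSpace ℝ (Fin (d + 1))) M]

/-- The coordinate vector `∂_i` of the chart `φ`, at the point with coordinates `y`. -/
noncomputable def coordVec (φ : OpenPartialHomeomorph M (EuclideanSpace ℝ (Fin (d + 1))))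
    (y : EuclideanSpace ℝ (Fin (d + 1))) (i : Fin (d + 1)) :
    TangentSpace (𝓡 (d + 1)) (φ.symm y) :=
  mfderiv (𝓡 (d + 1)) (𝓡 (d + 1)) φ.symm y (EuclideanSpace.single i (1 : ℝ))

/-- The components `u^a` of a vector field in the chart `φ`, so that `u = u^a ∂_a`. -/
noncomputable def vecComp (φ : OpenPartialHomeomorph M (EuclideanSpace ℝ (Fin (d + 1))))
    (u : (p : M) → TangentSpace (𝓡 (d + 1)) p)
    (y : EuclideanSpace ℝ (Fin (d + 1))) (a : Fin (d + 1)) : ℝ :=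
  let v : EuclideanSpace ℝ (Fin (d + 1)) :=
    mfderiv (𝓡 (d + 1)) (𝓡 (d + 1)) φ (φ.symm y) (u (φ.symm y))
  v a

variable [IsManifold (𝓡 (d + 1)) ∞ M] (g : LorentzMetric d M)

/-- The components `g_{ab} = g(∂_a, ∂_b)` of the metric in the chart `φ`. -/
noncomputable def comp (φ : OpenPartialHomeomorph M (EuclideanSpace ℝ (Fin (d + 1))))
    (y : EuclideanSpace ℝ (Fin (d + 1))) : Matrix (Fin (d + 1)) (Fin (d + 1)) ℝ :=
  Matrix.of fun a b => g.val (φ.symm y) (coordVec φ y a) (coordVec φ y b)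

/-- `u` is a smooth unit timelike vector field: `g(u, u) = -1`. -/
def IsUnitTimelike (u : (p : M) → TangentSpace (𝓡 (d + 1)) p) : Prop :=
  ContMDiff (𝓡 (d + 1)) (𝓡 (d + 1)).tangent ∞
      (fun p => (⟨p, u p⟩ : TangentBundle (𝓡 (d + 1)) M)) ∧
    ∀ p, g.val p (u p) (u p) = -1

/-- The shear tensor of `u` vanishes identically (in all coordinate systems). -/
def IsShearFree (u : (p : M) → TangentSpace (𝓡 (d + 1)) p) : Prop :=
  ∀ φ ∈ IsManifold.maximalAtlas (𝓡 (d + 1)) ∞ M, ∀ y ∈ φ.target, ∀ a b,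
    Coord.shear (g.comp φ) (vecComp φ u) a b y = 0

/-- The twist tensor of `u` vanishes identically (in all coordinate systems). -/
def IsTwistFree (u : (p : M) → TangentSpace (𝓡 (d + 1)) p) : Prop :=
  ∀ φ ∈ IsManifold.maximalAtlas (𝓡 (d + 1)) ∞ M, ∀ y ∈ φ.target, ∀ a b,
    Coord.twist (g.comp φ) (vecComp φ u) a b y = 0

/-- The spacetime is purely electric with respect to `u`: the magnetic part of the Weyl tensor
vanishes identically (in all coordinate systems). -/
def IsPurelyElectric (u : (p : M) → TangentSpace (𝓡 (d + 1)) p) : Prop :=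
  ∀ φ ∈ IsManifold.maximalAtlas (𝓡 (d + 1)) ∞ M, ∀ y ∈ φ.target, ∀ a b c e,
    Coord.weylMagnetic (g.comp φ) (vecComp φ u) a b c e y = 0

/-- The spatial coordinates `x = (x^1, …, x^d)` of the coordinate point `y = (t, x^1, …, x^d)`. -/
noncomputable def spatial (y : EuclideanSpace ℝ (Fin (d + 1))) : EuclideanSpace ℝ (Fin d) :=
  WithLp.toLp 2 fun α => y α.succ

/-- In the coordinates `φ = (t, x)` the vector field `u` is `V⁻¹ ∂_t` and the line element is
`-V(t,x)² dt² + P(t,x)² ξ_{αβ}(x) dx^α dx^β`, with smooth functions `V, P > 0` and a smooth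
Riemannian metric `ξ` that depends on `x` only. -/
def HasAdaptedForm (u : (p : M) → TangentSpace (𝓡 (d + 1)) p)
    (φ : OpenPartialHomeomorph M (EuclideanSpace ℝ (Fin (d + 1)))) : Prop :=
  ∃ (V P : EuclideanSpace ℝ (Fin (d + 1)) → ℝ)
    (ξ : EuclideanSpace ℝ (Fin d) → Matrix (Fin d) (Fin d) ℝ),
    ContDiffOn ℝ ∞ V φ.target ∧ ContDiffOn ℝ ∞ P φ.target ∧
    (∀ α β, ContDiffOn ℝ ∞ (fun x => ξ x α β) (spatial '' φ.target)) ∧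
    (∀ x ∈ spatial '' φ.target, (ξ x).PosDef) ∧
    ∀ y ∈ φ.target,
      0 < V y ∧ 0 < P y ∧
      u (φ.symm y) = (V y)⁻¹ • coordVec φ y 0 ∧
      g.comp φ y 0 0 = -(V y) ^ 2 ∧
      (∀ α : Fin d, g.comp φ y 0 α.succ = 0 ∧ g.comp φ y α.succ 0 = 0) ∧
      ∀ α β : Fin d, g.comp φ y α.succ β.succ = (P y) ^ 2 * ξ (spatial y) α β

/-- The coordinates `φ = (t, x)` are adapted to `u`: `u` is a positive multiple of `∂_t`, the
hypersurfaces of constant `t` are orthogonal to `u`, and any two points of the coordinate domain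
with the same `x` are joined by a line of constant `x` in the domain. -/
def IsAdaptedChart (u : (p : M) → TangentSpace (𝓡 (d + 1)) p)
    (φ : OpenPartialHomeomorph M (EuclideanSpace ℝ (Fin (d + 1)))) : Prop :=
  (∀ y ∈ φ.target, ∃ V : ℝ, 0 < V ∧ u (φ.symm y) = V⁻¹ • coordVec φ y 0) ∧
  (∀ y ∈ φ.target, ∀ α : Fin d, g.val (φ.symm y) (u (φ.symm y)) (coordVec φ y α.succ) = 0) ∧
  ∀ y ∈ φ.target, ∀ z ∈ φ.target, spatial y = spatial z → segment ℝ y z ⊆ φ.target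

end LorentzMetric

/-!
Magnetic part. If `u` has neither shear nor twist, then `∇_b u_a = θ h_{ab} / (n - 1) - u_b A_a`, where
`A` is the acceleration. By the Ricci identity `R_{abcd} u^a` is an antisymmetrized second
derivative of `u`, and inserting this expression shows that it is `p_c h_{db} - p_d h_{cb}`, with
`p` minus the gradient of `θ / (n - 1)`, up to terms that carry a factor `u_c` or `u_d`
(`Coord.IsObserverOn.exists_sum_riemann_mul_eq`). The first part is pure trace, so the trace-free
Weyl tensor does not contain it: `C_{efkc} u^k` is of the form `u_e Z_{fc} - u_f Z_{ec}`
(`Coord.IsObserverOn.exists_sum_weyl_mul_eq`), and this is annihilated by the projections in the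
magnetic part. The symmetries of the curvature tensor that the traces need are read off its
expression by second derivatives of the metric (`Coord.IsMetricOn.riemann_eq`).

Adapted coordinates. A smooth vector field has a flow that is smooth in
time and initial value together (`exists_contDiffOn_flow`): after rescaling of time, integral
curves are the zeros of a smooth map between Banach spaces of curves, to which the inverse function
theorem applies. The flow box theorem gives coordinates with `u = ∂_0`. The one-form `η = u_a dy^a`
satisfies `dη = A ∧ η` because the twist vanishes, so its kernel is integrable. The leaf through a
point of the `0`-axis is swept out by the integral curves of `y ↦ v + η_y(v) ∂_0`, for constant `v`
(`exists_leafCoordinates`); along such a curve the value of `η` on a variation solves a homogeneous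
linear equation, hence stays zero (`apply_fderiv_eq_zero_of_isotropic`). In the coordinates built
from the leaves `u` is a positive multiple of `∂_t` and orthogonal to the slices of constant `t`.

Line element. In any adapted coordinates vanishing shear says `∂_t g_{αβ} =
c g_{αβ}` with a factor `c` common to all `α, β` (`Coord.IsObserverOn.exists_pd_zero_eq`).
Therefore `g_{αβ}` divided by `∑ γ, g_{γγ}`, which is positive as vectors orthogonal to `u` are
spacelike, is constant along the lines of constant `x`; this quotient is `ξ`, and `P ^ 2` is the
sum.
-/

open scoped Topology

universe u

/-! ### The inverse function theorem -/

/-- Inverse function theorem, in the form of a local diffeomorphism: a map that is `C^∞` on an open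
set and has an invertible derivative at a point of it restricts to an open partial homeomorphism
that is `C^∞` in both directions. -/
theorem ContDiffOn.exists_openPartialHomeomorph {E F : Type*}
    [NormedAddCommGroup E] [NormedSpace ℝ E] [CompleteSpace E]
    [NormedAddCommGroup F] [NormedSpace ℝ F] {f : E → F} {s : Set E} {a : E}
    (hs : IsOpen s) (ha : a ∈ s) (hf : ContDiffOn ℝ ∞ f s) (f' : E ≃L[ℝ] F)
    (hf' : HasFDerivAt f (f' : E →L[ℝ] F) a) :
    ∃ e : OpenPartialHomeomorph E F, a ∈ e.source ∧ e.source ⊆ s ∧ (e : E → F) = f ∧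
      ContDiffOn ℝ ∞ e e.source ∧ ContDiffOn ℝ ∞ e.symm e.target ∧
      ∀ x ∈ e.source, ∃ A : E ≃L[ℝ] F, HasFDerivAt f (A : E →L[ℝ] F) x := by
  have hne : (∞ : WithTop ℕ∞) ≠ 0 := by simp
  have hfa : ContDiffAt ℝ ∞ f a := hf.contDiffAt (hs.mem_nhds ha)
  let e₀ := hfa.toOpenPartialHomeomorph f hf' hne
  have he₀ : (e₀ : E → F) = f := rfl
  -- the derivative stays invertible on a neighbourhood of `a`
  have hinv : ∀ᶠ x in 𝓝 a, ∃ A : E ≃L[ℝ] F, HasFDerivAt f (A : E →L[ℝ] F) x := by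
    have hcont : ContinuousAt (fderiv ℝ f) a :=
      (hfa.fderiv_right (m := 0) (by simp)).continuousAt
    have hmem : Set.range ((↑) : (E ≃L[ℝ] F) → E →L[ℝ] F) ∈ 𝓝 (fderiv ℝ f a) := by
      rw [hf'.fderiv]; exact ContinuousLinearEquiv.nhds f'
    filter_upwards [hcont hmem, hs.mem_nhds ha] with x hx hxs
    obtain ⟨A, hA⟩ := hx
    refine ⟨A, ?_⟩
    rw [hA]
    exact ((hf.contDiffAt (hs.mem_nhds hxs)).differentiableAt hne).hasFDerivAt
  obtain ⟨t, ht, hto, hat⟩ := eventually_nhds_iff.1 (hinv.and (hs.mem_nhds ha))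
  refine ⟨e₀.restrOpen t hto, ?_, ?_, ?_, ?_, ?_, ?_⟩
  · exact ⟨hfa.mem_toOpenPartialHomeomorph_source hf' hne, hat⟩
  · exact fun x hx => (ht x hx.2).2
  · rfl
  · exact hf.mono fun x hx => (ht x hx.2).2
  · intro y hy
    have hx := (e₀.restrOpen t hto).map_target hy
    obtain ⟨⟨A, hA⟩, hxs⟩ := ht _ hx.2
    exact ((e₀.restrOpen t hto).contDiffAt_symm hy hA
      (hf.contDiffAt (hs.mem_nhds hxs))).contDiffWithinAt
  · exact fun x hx => (ht x hx.2).1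

/-! ### Smooth dependence of solutions of differential equations on the initial value -/

section Superposition

/-- The bilinear map `(A, η) ↦ (k ↦ B (A k) (η k))` on spaces of continuous functions obtained by
applying a bounded bilinear map `B` pointwise. -/
noncomputable def ContinuousMap.pointwiseBilin (K : Type*) [TopologicalSpace K] [CompactSpace K]
    {G E F : Type*} [NormedAddCommGroup G] [NormedSpace ℝ G] [NormedAddCommGroup E]
    [NormedSpace ℝ E] [NormedAddCommGroup F] [NormedSpace ℝ F] (B : G →L[ℝ] E →L[ℝ] F) :
    C(K, G) →L[ℝ] C(K, E) →L[ℝ] C(K, F) :=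
  LinearMap.mkContinuous₂
    (LinearMap.mk₂ ℝ (fun (A : C(K, G)) (η : C(K, E)) =>
        (⟨fun k => B (A k) (η k), by fun_prop⟩ : C(K, F)))
      (fun A A' η => by ext; simp) (fun c A η => by ext; simp)
      (fun A η ζ => by ext; simp) (fun c A η => by ext; simp)) ‖B‖
    (fun A η => by
      refine (ContinuousMap.norm_le _ (by positivity)).2 fun k => ?_
      exact (B.le_opNorm₂ _ _).trans (by
        gcongr
        exacts [A.norm_coe_le_norm k, η.norm_coe_le_norm k]))

variable {K : Type*} [TopologicalSpace K] [CompactSpace K]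

theorem ContinuousMap.pointwiseBilin_apply {G E F : Type*} [NormedAddCommGroup G]
    [NormedSpace ℝ G] [NormedAddCommGroup E] [NormedSpace ℝ E] [NormedAddCommGroup F]
    [NormedSpace ℝ F] (B : G →L[ℝ] E →L[ℝ] F) (A : C(K, G)) (η : C(K, E)) (k : K) :
    ContinuousMap.pointwiseBilin K B A η k = B (A k) (η k) := rfl

/-- A continuous function is uniformly continuous along a curve with compact parameter space. -/
theorem ContinuousMap.exists_forall_norm_comp_sub_le {E G : Type*}
    [NormedAddCommGroup E] [NormedAddCommGroup G] (f : E → G) (hf : Continuous f) (γ : C(K, E))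
    {c : ℝ} (hc : 0 < c) :
    ∃ δ > 0, ∀ η : C(K, E), ‖η‖ < δ → ∀ k, ‖f (γ k + η k) - f (γ k)‖ ≤ c := by
  obtain ⟨δ, hδ, hball⟩ := Metric.tendsto_nhds_nhds.1
    ((ContinuousMap.continuous_postcomp (X := K) ⟨f, hf⟩).tendsto γ) c hc
  refine ⟨δ, hδ, fun η hη k => ?_⟩
  have h1 : dist (γ + η) γ < δ := by rwa [dist_eq_norm, add_sub_cancel_left]
  have h2 := hball h1
  rw [dist_eq_norm] at h2
  exact (ContinuousMap.norm_coe_le_norm _ k).trans h2.le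

/-- If the derivative of `f` at `x` is `B (A x)`, then the derivative of `γ ↦ f ∘ γ` is obtained by
applying `B` pointwise to `A ∘ γ`; so it depends on `γ` through a superposition operator again. -/
theorem ContinuousMap.hasFDerivAt_comp_left {G E F : Type*} [NormedAddCommGroup G]
    [NormedSpace ℝ G] [NormedAddCommGroup E] [NormedSpace ℝ E] [NormedAddCommGroup F]
    [NormedSpace ℝ F] (B : G →L[ℝ] E →L[ℝ] F) (f : C(E, F)) (A : C(E, G))
    (h : ∀ x, HasFDerivAt f (B (A x)) x) (γ : C(K, E)) :
    HasFDerivAt (fun γ : C(K, E) => f.comp γ) (pointwiseBilin K B (A.comp γ)) γ := by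
  rw [hasFDerivAt_iff_isLittleO_nhds_zero, Asymptotics.isLittleO_iff]
  intro c hc
  set f' : E → E →L[ℝ] F := fun x => B (A x) with hf'_def
  have hf' : Continuous f' := by fun_prop
  obtain ⟨δ, hδ, hball⟩ := exists_forall_norm_comp_sub_le f' hf' γ hc
  filter_upwards [Metric.ball_mem_nhds (0 : C(K, E)) hδ] with η hη
  rw [mem_ball_zero_iff] at hη
  refine (ContinuousMap.norm_le _ (by positivity)).2 fun k => ?_
  -- mean value inequality on the segment from `γ k` to `γ k + η k`; the derivative at each of its
  -- points is compared with the one at `γ k` by moving the whole curve by a constant vector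
  have key : ∀ v ∈ Metric.ball (0 : E) δ, ‖f' (γ k + v) - f' (γ k)‖ ≤ c := by
    intro v hv
    rw [mem_ball_zero_iff] at hv
    exact hball (ContinuousMap.const K v)
      ((ContinuousMap.norm_lt_iff _ hδ).2 fun _ => hv) k
  have hmv := (convex_ball (0 : E) δ).norm_image_sub_le_of_norm_hasFDerivWithin_le
    (f := fun v => f (γ k + v) - f' (γ k) v) (f' := fun v => f' (γ k + v) - f' (γ k)) (C := c)
    (x := 0) (y := η k)
    (fun v _ => by
      have h1 : HasFDerivAt (fun v => f (γ k + v)) (f' (γ k + v)) v := by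
        simpa [Function.comp_def] using (h (γ k + v)).comp v ((hasFDerivAt_id v).const_add (γ k))
      exact (h1.sub (f' (γ k)).hasFDerivAt).hasFDerivWithinAt)
    key (Metric.mem_ball_self hδ)
    (mem_ball_zero_iff.2 ((η.norm_coe_le_norm k).trans_lt hη))
  calc ‖(f.comp (γ + η) - f.comp γ - pointwiseBilin K B (A.comp γ) η) k‖
      = ‖f (γ k + η k) - f' (γ k) (η k) - (f (γ k + 0) - f' (γ k) 0)‖ := by
        congr 1
        simp [pointwiseBilin_apply, hf'_def]
        abel
    _ ≤ c * ‖η k - 0‖ := hmv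
    _ ≤ c * ‖η‖ := by
        rw [sub_zero]
        gcongr
        exact η.norm_coe_le_norm k

/-- The superposition operator `γ ↦ f ∘ γ` on a space of continuous functions inherits the
regularity of `f`. -/
theorem ContinuousMap.contDiff_comp_left {E F : Type u}
    [NormedAddCommGroup E] [NormedSpace ℝ E] [NormedAddCommGroup F] [NormedSpace ℝ F]
    (f : C(E, F)) (hf : ContDiff ℝ ∞ f) :
    ContDiff ℝ ∞ (fun γ : C(K, E) => f.comp γ) := by
  rw [contDiff_infty]
  intro n
  induction n generalizing F with
  | zero => exact contDiff_zero.2 (ContinuousMap.continuous_postcomp f)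
  | succ n ih =>
    have hf' : ContDiff ℝ ∞ (fderiv ℝ f) := hf.fderiv_right (by simp)
    -- the derivative of `γ ↦ f ∘ γ` is a superposition operator with values in `C(K, E →L[ℝ] F)`;
    -- this is why `E` and `F` share a universe
    have key (G : Type u) [NormedAddCommGroup G] [NormedSpace ℝ G] (B : G →L[ℝ] E →L[ℝ] F)
        (A : C(E, G)) (hA : ContDiff ℝ ∞ A) (h : ∀ x, HasFDerivAt f (B (A x)) x) :
        ContDiff ℝ (n + 1 : ℕ) (fun γ : C(K, E) => f.comp γ) := by
      push_cast
      rw [contDiff_succ_iff_hasFDerivAt]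
      exact ⟨fun γ => pointwiseBilin K B (A.comp γ),
        (pointwiseBilin K B).contDiff.comp (ih A hA),
        fun γ => hasFDerivAt_comp_left B f A h γ⟩
    exact key (E →L[ℝ] F) (ContinuousLinearMap.id ℝ _) ⟨fderiv ℝ f, hf'.continuous⟩ hf'
      fun x => (hf.differentiable (by simp) x).hasFDerivAt

end Superposition

section Flow

variable {E : Type u} [NormedAddCommGroup E] [NormedSpace ℝ E]

/-- Continuous curves `[-1, 1] → E`. -/
abbrev CurveSpace (E : Type*) [TopologicalSpace E] : Type _ := C(Set.Icc (-1 : ℝ) 1, E)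

namespace CurveSpace

theorem neg_one_le_one : (-1 : ℝ) ≤ 1 := by norm_num

/-- The extension of a curve to `ℝ` by constants. -/
noncomputable def extend {E : Type*} [TopologicalSpace E] (γ : CurveSpace E) : ℝ → E :=
  Set.IccExtend neg_one_le_one γ

theorem continuous_extend {E : Type*} [TopologicalSpace E] (γ : CurveSpace E) :
    Continuous γ.extend :=
  γ.continuous.Icc_extend'

theorem extend_of_mem {E : Type*} [TopologicalSpace E] (γ : CurveSpace E) {r : ℝ}
    (hr : r ∈ Set.Icc (-1 : ℝ) 1) : γ.extend r = γ ⟨r, hr⟩ :=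
  Set.IccExtend_of_mem _ _ hr

/-- The primitive of a continuous curve that vanishes at time `0`. -/
noncomputable def primitive : CurveSpace E →L[ℝ] CurveSpace E :=
  LinearMap.mkContinuous
    { toFun := fun γ => ⟨fun s => ∫ r in (0 : ℝ)..s, extend γ r,
        (intervalIntegral.continuous_primitive
          (fun a b => (continuous_extend γ).intervalIntegrable a b) 0).comp continuous_subtype_val⟩
      map_add' := fun γ η => by
        ext s
        exact intervalIntegral.integral_add ((continuous_extend γ).intervalIntegrable _ _)
          ((continuous_extend η).intervalIntegrable _ _)
      map_smul' := fun c γ => by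
        ext s
        exact intervalIntegral.integral_smul c _ } 1
    (fun γ => by
      rw [one_mul]
      refine (ContinuousMap.norm_le _ (norm_nonneg _)).2 fun s => ?_
      refine (intervalIntegral.norm_integral_le_of_norm_le_const (a := (0 : ℝ)) (b := s)
        (C := ‖γ‖) (fun r _ => γ.norm_coe_le_norm _)).trans ?_
      rw [sub_zero]
      exact mul_le_of_le_one_right (norm_nonneg _) (abs_le.2 s.2))

theorem primitive_apply (γ : CurveSpace E) (s : Set.Icc (-1 : ℝ) 1) :
    primitive γ s = ∫ r in (0 : ℝ)..s, γ.extend r := rfl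

/-- The constant curves. -/
noncomputable def const : E →L[ℝ] CurveSpace E :=
  LinearMap.mkContinuous
    { toFun := fun x => ContinuousMap.const _ x
      map_add' := fun _ _ => rfl
      map_smul' := fun _ _ => rfl } 1
    (fun x => by
      rw [one_mul]
      exact (ContinuousMap.norm_le _ (norm_nonneg _)).2 fun _ => le_rfl)

theorem const_apply (x : E) (s : Set.Icc (-1 : ℝ) 1) : const x s = x := rfl

/-- The curve `r ↦ γ (s r)`. -/
noncomputable def rescale {E : Type*} [TopologicalSpace E] (s : Set.Icc (-1 : ℝ) 1)
    (γ : CurveSpace E) : CurveSpace E :=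
  ⟨fun r => γ.extend (s * r), γ.continuous_extend.comp (by fun_prop)⟩

theorem rescale_apply {E : Type*} [TopologicalSpace E] (s : Set.Icc (-1 : ℝ) 1)
    (γ : CurveSpace E) (r : Set.Icc (-1 : ℝ) 1) :
    rescale s γ r = γ.extend (s * r) := rfl

theorem mul_mem {s r : ℝ} (hs : s ∈ Set.Icc (-1 : ℝ) 1) (hr : r ∈ Set.Icc (-1 : ℝ) 1) :
    s * r ∈ Set.Icc (-1 : ℝ) 1 := by
  rw [Set.mem_Icc, ← abs_le] at *
  rw [abs_mul]
  exact mul_le_one₀ hs (abs_nonneg _) hr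

/-- If `γ' = τ X(γ)`, then `r ↦ γ (s r)` has velocity `s τ X`; both equations are stated in
integrated form. -/
theorem rescale_eq_of_eq {X : C(E, E)} {x : E} {τ : ℝ} {γ : CurveSpace E}
    (h : γ = const x + τ • primitive (X.comp γ)) (s : Set.Icc (-1 : ℝ) 1) :
    rescale s γ = const x + ((s : ℝ) * τ) • primitive (X.comp (rescale s γ)) := by
  ext r
  have h1 : rescale s γ r = x + τ • ∫ σ in (0 : ℝ)..(s * r), extend (X.comp γ) σ := by
    rw [rescale_apply, extend_of_mem γ (mul_mem s.2 r.2)]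
    exact DFunLike.congr_fun h _
  have h2 : (s : ℝ) • ∫ σ in (0 : ℝ)..r, extend (X.comp (rescale s γ)) σ
      = ∫ σ in (0 : ℝ)..(s * r), extend (X.comp γ) σ := by
    have h3 : ∫ σ in (0 : ℝ)..r, extend (X.comp (rescale s γ)) σ
        = ∫ σ in (0 : ℝ)..r, extend (X.comp γ) (s * σ) := by
      refine intervalIntegral.integral_congr fun σ hσ => ?_
      have hσ' : σ ∈ Set.Icc (-1 : ℝ) 1 :=
        Set.uIcc_subset_Icc (by norm_num) r.2 hσ
      simp only [extend_of_mem _ hσ', extend_of_mem _ (mul_mem s.2 hσ')]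
      simp [rescale_apply, extend_of_mem _ (mul_mem s.2 hσ')]
    rw [h3, intervalIntegral.smul_integral_comp_mul_left, mul_zero]
  rw [h1, ← h2, smul_smul, mul_comm τ]
  rfl

theorem norm_rescale_sub_const_le (s : Set.Icc (-1 : ℝ) 1) (γ : CurveSpace E) (x : E) :
    ‖rescale s γ - const x‖ ≤ ‖γ - const x‖ := by
  refine (ContinuousMap.norm_le _ (norm_nonneg _)).2 fun r => ?_
  have h := (γ - const x).norm_coe_le_norm ⟨s * r, mul_mem s.2 r.2⟩
  rwa [← extend_of_mem] at h

end CurveSpace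

open CurveSpace in
/-- The flow of a smooth vector field is smooth in time and initial value together. The rescaled
integral curves `γ' = τ X(γ)`, `γ(0) = x` on `[-1, 1]` are the solutions of an equation in a Banach
space of curves, to which the inverse function theorem applies at `τ = 0`. -/
theorem exists_contDiffOn_flow [CompleteSpace E] {X : E → E} (hX : ContDiff ℝ ∞ X) (x₀ : E) :
    ∃ (Φ : ℝ × E → E) (δ : ℝ), 0 < δ ∧ ContDiffOn ℝ ∞ Φ (Metric.ball (0, x₀) δ) ∧
      ∀ p ∈ Metric.ball ((0 : ℝ), x₀) δ, Φ (0, p.2) = p.2 ∧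
        HasDerivAt (fun t => Φ (t, p.2)) (X (Φ p)) p.1 := by
  let Xc : C(E, E) := ⟨X, hX.continuous⟩
  let N : CurveSpace E → CurveSpace E := fun γ => Xc.comp γ
  have hN : ContDiff ℝ ∞ N := ContinuousMap.contDiff_comp_left Xc hX
  -- `Γ (τ, x)` solves `γ = x + τ ∫ X(γ)`, that is, `H ((τ, x), γ) = ((τ, x), 0)`
  let H : (ℝ × E) × CurveSpace E → (ℝ × E) × CurveSpace E :=
    fun q => (q.1, q.2 - const q.1.2 - q.1.1 • primitive (N q.2))
  have hH : ContDiff ℝ ∞ H := by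
    have h1 : ContDiff ℝ ∞ fun q : (ℝ × E) × CurveSpace E => primitive (N q.2) :=
      (primitive (E := E)).contDiff.comp (hN.comp contDiff_snd)
    have h2 : ContDiff ℝ ∞ fun q : (ℝ × E) × CurveSpace E => const q.1.2 :=
      (const (E := E)).contDiff.comp (contDiff_snd.comp contDiff_fst)
    exact contDiff_fst.prodMk ((contDiff_snd.sub h2).sub
      ((contDiff_fst.comp contDiff_fst).smul h1))
  let a : (ℝ × E) × CurveSpace E := ((0, x₀), const x₀)
  -- at `τ = 0` the equation is affine in the curve
  let A : ℝ × E →L[ℝ] CurveSpace E :=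
    -(const.comp (ContinuousLinearMap.snd ℝ ℝ E)) -
      (ContinuousLinearMap.fst ℝ ℝ E).smulRight (primitive (N (const x₀)))
  let H' : ((ℝ × E) × CurveSpace E) ≃L[ℝ] ((ℝ × E) × CurveSpace E) :=
    (ContinuousLinearEquiv.refl ℝ (ℝ × E)).skewProd (ContinuousLinearEquiv.refl ℝ (CurveSpace E)) A
  have hH' : HasFDerivAt H (H' : _ →L[ℝ] _) a := by
    have h0 : HasFDerivAt (fun q : (ℝ × E) × CurveSpace E => primitive (N q.2))
        (fderiv ℝ (fun q : (ℝ × E) × CurveSpace E => primitive (N q.2)) a) a :=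
      (((primitive (E := E)).contDiff.comp
        (hN.comp contDiff_snd)).differentiable (by simp) a).hasFDerivAt
    have h1 := (hasFDerivAt_fst (𝕜 := ℝ) (p := a)).prodMk
      (((hasFDerivAt_snd (𝕜 := ℝ) (p := a)).sub
        (const.hasFDerivAt.comp a ((hasFDerivAt_snd (𝕜 := ℝ) (p := a.1)).comp a
          (hasFDerivAt_fst (𝕜 := ℝ) (p := a))))).sub
        (((hasFDerivAt_fst (𝕜 := ℝ) (p := a.1)).comp a
          (hasFDerivAt_fst (𝕜 := ℝ) (p := a))).smul h0))
    refine h1.congr_fderiv ?_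
    ext : 1
    · ext <;> simp [H', A, a]
    · ext <;> simp [H', A, a]
  obtain ⟨e, hae, -, heH, -, hsymm, -⟩ := ContDiffOn.exists_openPartialHomeomorph isOpen_univ
    (Set.mem_univ a) hH.contDiffOn H' hH'
  let Γ : ℝ × E → CurveSpace E := fun p => (e.symm (p, 0)).2
  have hHa : H a = ((0, x₀), 0) := by simp [H, a]
  have hmem0 : (((0, x₀), 0) : (ℝ × E) × CurveSpace E) ∈ e.target := by
    rw [← hHa, ← heH]; exact e.map_source hae
  have hΓ0 : Γ (0, x₀) = const x₀ := by
    have : e.symm ((0, x₀), 0) = a := by rw [← hHa, ← heH]; exact e.left_inv hae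
    simp only [Γ, this, a]
  let D : Set (ℝ × E) := (fun p => (p, (0 : CurveSpace E))) ⁻¹' e.target
  have hD : IsOpen D := e.open_target.preimage (by fun_prop)
  have hΓsmooth : ContDiffOn ℝ ∞ Γ D :=
    contDiff_snd.comp_contDiffOn (hsymm.comp (by fun_prop) fun p hp => hp)
  have hΓeq : ∀ p ∈ D, Γ p = const p.2 + p.1 • primitive (N (Γ p)) := by
    intro p hp
    have h1 : H (e.symm (p, 0)) = (p, 0) := by rw [← heH]; exact e.right_inv hp
    have h2 : (e.symm (p, 0)).1 = p := congrArg Prod.fst h1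
    have h3 : (e.symm (p, 0)).2 - const (e.symm (p, 0)).1.2
      - (e.symm (p, 0)).1.1 • primitive (N (e.symm (p, 0)).2) = 0 := congrArg Prod.snd h1
    rw [h2, sub_sub, sub_eq_zero] at h3
    exact h3
  have hΓuniq : ∀ p (γ : CurveSpace E), (p, γ) ∈ e.source →
      γ = const p.2 + p.1 • primitive (N γ) → Γ p = γ := by
    intro p γ hp hγ
    have h1 : e (p, γ) = (p, 0) := by
      rw [heH]
      simp only [H, Prod.mk.injEq, true_and]
      rw [sub_sub, sub_eq_zero]
      exact hγ
    simp only [Γ, ← h1, e.left_inv hp]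
  obtain ⟨ρ, hρ, hρs⟩ := Metric.isOpen_iff.1 e.open_source a hae
  have hΓcont : ContinuousAt Γ (0, x₀) := hΓsmooth.continuousOn.continuousAt (hD.mem_nhds hmem0)
  obtain ⟨δ', hδ', hδ'b⟩ := Metric.mem_nhds_iff.1 (Filter.inter_mem (hD.mem_nhds hmem0)
    (hΓcont (Metric.ball_mem_nhds _ hρ)))
  set δ := min δ' ρ with hδ
  have hδpos : 0 < δ := lt_min hδ' hρ
  have hmem : ∀ t x, (t, x) ∈ Metric.ball ((0 : ℝ), x₀) δ ↔ |t| < δ ∧ dist x x₀ < δ := by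
    intro t x
    rw [Metric.mem_ball, Prod.dist_eq, max_lt_iff]
    simp
  -- uniqueness: the curve with the smaller time scale is the rescaled curve
  have hscale : ∀ p ∈ Metric.ball ((0 : ℝ), x₀) δ, ∀ s : Set.Icc (-1 : ℝ) 1,
      Γ (s * p.1, p.2) = rescale s (Γ p) := by
    rintro ⟨τ, x⟩ hp s
    have hp' := hδ'b (Metric.ball_subset_ball (min_le_left _ _) hp)
    rw [hmem] at hp
    refine hΓuniq _ _ (hρs ?_) (rescale_eq_of_eq (hΓeq _ hp'.1) s)
    rw [Metric.mem_ball, Prod.dist_eq, max_lt_iff]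
    constructor
    · rw [Prod.dist_eq, max_lt_iff]
      refine ⟨?_, hp.2.trans_le (min_le_right _ _)⟩
      simp only [a, dist_zero_right, Real.norm_eq_abs, abs_mul]
      calc |(s : ℝ)| * |τ| ≤ 1 * |τ| := by gcongr; exact abs_le.2 s.2
        _ < ρ := by rw [one_mul]; exact hp.1.trans_le (min_le_right _ _)
    · rw [dist_eq_norm]
      refine (norm_rescale_sub_const_le s _ _).trans_lt ?_
      have := hp'.2
      rwa [Set.mem_preimage, Metric.mem_ball, hΓ0, dist_eq_norm] at this
  let one : Set.Icc (-1 : ℝ) 1 := ⟨1, by norm_num⟩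
  refine ⟨fun p => Γ p one, δ / 2, by positivity, ?_, ?_⟩
  · exact (ContinuousMap.evalCLM ℝ one).contDiff.comp_contDiffOn (hΓsmooth.mono fun p hp =>
      (hδ'b (Metric.ball_subset_ball ((half_lt_self hδpos).le.trans (min_le_left _ _)) hp)).1)
  · rintro ⟨t, x⟩ hp
    have hp2 : |t| < δ / 2 ∧ dist x x₀ < δ / 2 := by
      rw [Metric.mem_ball, Prod.dist_eq, max_lt_iff] at hp
      simpa using hp
    have hb : ((δ / 2, x) : ℝ × E) ∈ Metric.ball ((0 : ℝ), x₀) δ :=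
      (hmem _ _).2 ⟨by rw [abs_of_pos (by positivity)]; linarith, by linarith⟩
    have hbD := (hδ'b (Metric.ball_subset_ball (min_le_left _ _) hb)).1
    -- all values on the orbit of `x` are read off one curve
    have hval : ∀ r, |r| < δ / 2 → Γ (r, x) one
        = x + (δ / 2) • ∫ σ in (0 : ℝ)..(r / (δ / 2)), extend (N (Γ (δ / 2, x))) σ := by
      intro r hr
      have hs : r / (δ / 2) ∈ Set.Icc (-1 : ℝ) 1 := by
        rw [Set.mem_Icc, ← abs_le, abs_div, abs_of_pos (half_pos hδpos)]
        exact (div_le_one (by positivity)).2 hr.le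
      have h1 := hscale _ hb ⟨_, hs⟩
      simp only [div_mul_cancel₀ r (half_pos hδpos).ne'] at h1
      rw [h1, rescale_apply, extend_of_mem _ (mul_mem hs one.2)]
      have h2 := DFunLike.congr_fun (hΓeq _ hbD)
        ⟨r / (δ / 2) * one, mul_mem hs one.2⟩
      rw [h2]
      simp [primitive_apply, const_apply, one]
    refine ⟨?_, ?_⟩
    · show Γ (0, x) one = x
      rw [hval 0 (by simpa using hδpos)]
      simp
    · have hs : t / (δ / 2) ∈ Set.Icc (-1 : ℝ) 1 := by
        rw [Set.mem_Icc, ← abs_le, abs_div, abs_of_pos (half_pos hδpos)]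
        exact (div_le_one (by positivity)).2 hp2.1.le
      have hXval : extend (N (Γ (δ / 2, x))) (t / (δ / 2)) = X (Γ (t, x) one) := by
        have h1 := hscale _ hb ⟨_, hs⟩
        simp only [div_mul_cancel₀ t (half_pos hδpos).ne'] at h1
        rw [h1, rescale_apply, extend_of_mem _ (mul_mem hs one.2), extend_of_mem _ hs]
        simp [N, Xc, one]
      have hder : HasDerivAt (fun r : ℝ =>
          x + (δ / 2) • ∫ σ in (0 : ℝ)..(r / (δ / 2)), extend (N (Γ (δ / 2, x))) σ)
          (X (Γ (t, x) one)) t := by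
        have hc := continuous_extend (N (Γ (δ / 2, x)))
        have h1 := intervalIntegral.integral_hasDerivAt_right
          (hc.intervalIntegrable 0 (t / (δ / 2)))
          hc.stronglyMeasurable.stronglyMeasurableAtFilter hc.continuousAt
        have h2 := (h1.scomp t ((hasDerivAt_id t).div_const (δ / 2))).const_smul (δ / 2)
        rw [hXval, smul_smul, mul_one_div_cancel (half_pos hδpos).ne', one_smul] at h2
        exact h2.const_add x
      refine hder.congr_of_eventuallyEq ?_
      filter_upwards [(isOpen_lt continuous_abs continuous_const).mem_nhds hp2.1] with r hr
      exact hval r hr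

/-- Near a point of an open set on which it is smooth, a function agrees with a globally smooth
function. -/
theorem ContDiffOn.exists_contDiff_eventuallyEq {E F : Type*} [NormedAddCommGroup E]
    [NormedSpace ℝ E] [FiniteDimensional ℝ E] [NormedAddCommGroup F] [NormedSpace ℝ F]
    {f : E → F} {s : Set E}
    (hs : IsOpen s) (hf : ContDiffOn ℝ ∞ f s) {x : E} (hx : x ∈ s) :
    ∃ f₁ : E → F, ContDiff ℝ ∞ f₁ ∧ f₁ =ᶠ[𝓝 x] f := by
  obtain ⟨r, hr, hrs⟩ := Metric.nhds_basis_closedBall.mem_iff.1 (hs.mem_nhds hx)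
  let χ : ContDiffBump x := ⟨r / 2, r, by positivity, by linarith⟩
  refine ⟨fun y => χ y • f y, ?_, ?_⟩
  · rw [contDiff_iff_contDiffAt]
    intro y
    by_cases hy : y ∈ s
    · exact χ.contDiffAt.smul (hf.contDiffAt (hs.mem_nhds hy))
    · have : (fun y => χ y • f y) =ᶠ[𝓝 y] fun _ => 0 := by
        have h1 : (tsupport χ)ᶜ ∈ 𝓝 y := by
          refine (isClosed_tsupport χ).isOpen_compl.mem_nhds fun h => hy (hrs ?_)
          rwa [χ.tsupport_eq] at h
        filter_upwards [h1] with z hz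
        rw [image_eq_zero_of_notMem_tsupport hz, zero_smul]
      exact contDiffAt_const.congr_of_eventuallyEq this
  · filter_upwards [χ.eventuallyEq_one] with y hy
    rw [hy]
    simp

end Flow

/-! ### Riemannian calculus in one coordinate system -/

namespace Coord

variable {n : ℕ} {Ω : Set (EuclideanSpace ℝ (Fin n))}

section PartialDerivatives

variable {f g : EuclideanSpace ℝ (Fin n) → ℝ} {y : EuclideanSpace ℝ (Fin n)} {k l : Fin n}

theorem pd_add (hf : DifferentiableAt ℝ f y) (hg : DifferentiableAt ℝ g y) :
    pd k (fun z => f z + g z) y = pd k f y + pd k g y := by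
  simp only [pd]
  rw [fderiv_fun_add hf hg]
  rfl

theorem pd_sub (hf : DifferentiableAt ℝ f y) (hg : DifferentiableAt ℝ g y) :
    pd k (fun z => f z - g z) y = pd k f y - pd k g y := by
  simp only [pd]
  rw [fderiv_fun_sub hf hg]
  rfl

theorem pd_mul (hf : DifferentiableAt ℝ f y) (hg : DifferentiableAt ℝ g y) :
    pd k (fun z => f z * g z) y = pd k f y * g y + f y * pd k g y := by
  simp only [pd]
  rw [fderiv_fun_mul hf hg]
  simp
  ring

theorem pd_const (c : ℝ) : pd k (fun _ => c) y = 0 := by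
  simp [pd]

theorem pd_const_mul (hf : DifferentiableAt ℝ f y) (c : ℝ) :
    pd k (fun z => c * f z) y = c * pd k f y := by
  rw [pd_mul (differentiableAt_const c) hf, pd_const]
  ring

theorem pd_sum {ι : Type*} {s : Finset ι} {f : ι → EuclideanSpace ℝ (Fin n) → ℝ}
    (hf : ∀ i ∈ s, DifferentiableAt ℝ (f i) y) :
    pd k (fun z => ∑ i ∈ s, f i z) y = ∑ i ∈ s, pd k (f i) y := by
  simp only [pd]
  rw [fderiv_fun_sum hf]
  simp

theorem pd_congr (hΩ : IsOpen Ω) (h : Set.EqOn f g Ω) (hy : y ∈ Ω) : pd k f y = pd k g y := by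
  simp only [pd]
  rw [(h.eventuallyEq_of_mem (hΩ.mem_nhds hy)).fderiv_eq]

theorem contDiffOn_pd (hΩ : IsOpen Ω) (hf : ContDiffOn ℝ ∞ f Ω) : ContDiffOn ℝ ∞ (pd k f) Ω :=
  (hf.fderiv_of_isOpen hΩ (m := ∞) (by simp)).clm_apply contDiffOn_const

theorem differentiableAt_of_contDiffOn (hΩ : IsOpen Ω) (hf : ContDiffOn ℝ ∞ f Ω) (hy : y ∈ Ω) :
    DifferentiableAt ℝ f y :=
  (hf.contDiffAt (hΩ.mem_nhds hy)).differentiableAt (by simp)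

theorem pd_comm (hΩ : IsOpen Ω) (hf : ContDiffOn ℝ ∞ f Ω) (hy : y ∈ Ω) :
    pd k (pd l f) y = pd l (pd k f) y := by
  have hfy : ContDiffAt ℝ ∞ f y := hf.contDiffAt (hΩ.mem_nhds hy)
  have hd : DifferentiableAt ℝ (fderiv ℝ f) y :=
    (hfy.fderiv_right (m := 1) (by norm_cast)).differentiableAt (by simp)
  have h2 : ∀ v w : EuclideanSpace ℝ (Fin n),
      fderiv ℝ (fun z => fderiv ℝ f z w) y v = fderiv ℝ (fderiv ℝ f) y v w := by
    intro v w
    rw [fderiv_clm_apply hd (differentiableAt_const w)]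
    simp
  have hs : IsSymmSndFDerivAt ℝ f y := hfy.isSymmSndFDerivAt (by
    simp only [minSmoothness_of_isRCLikeNormedField]
    exact WithTop.coe_le_coe.2 le_top)
  show fderiv ℝ (fun z => fderiv ℝ f z _) y _ = fderiv ℝ (fun z => fderiv ℝ f z _) y _
  rw [h2, h2]
  exact hs _ _

end PartialDerivatives

/-- `G` is the component matrix of a smooth pseudo-Riemannian metric on the open set `Ω`. -/
structure IsMetricOn (G : EuclideanSpace ℝ (Fin n) → Matrix (Fin n) (Fin n) ℝ)
    (Ω : Set (EuclideanSpace ℝ (Fin n))) : Prop where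
  isOpen : IsOpen Ω
  smooth : ∀ a b, ContDiffOn ℝ ∞ (fun y => G y a b) Ω
  symm : ∀ y a b, G y a b = G y b a
  isUnit_det : ∀ y ∈ Ω, IsUnit (G y).det

theorem contDiffOn_det {m : ℕ} {A : EuclideanSpace ℝ (Fin n) → Matrix (Fin m) (Fin m) ℝ}
    (hA : ∀ a b, ContDiffOn ℝ ∞ (fun y => A y a b) Ω) :
    ContDiffOn ℝ ∞ (fun y => (A y).det) Ω := by
  simp only [Matrix.det_apply']
  exact ContDiffOn.sum fun σ _ =>
    contDiffOn_const.mul (contDiffOn_prod fun i _ => hA (σ i) i)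

theorem contDiffOn_inv {A : EuclideanSpace ℝ (Fin n) → Matrix (Fin n) (Fin n) ℝ}
    (hA : ∀ a b, ContDiffOn ℝ ∞ (fun y => A y a b) Ω) (hdet : ∀ y ∈ Ω, IsUnit (A y).det)
    (a b : Fin n) : ContDiffOn ℝ ∞ (fun y => (A y)⁻¹ a b) Ω := by
  simp only [Matrix.inv_def, Matrix.smul_apply, Matrix.adjugate_apply, smul_eq_mul,
    Ring.inverse_eq_inv']
  refine ((contDiffOn_det hA).inv fun y hy => (hdet y hy).ne_zero).mul (contDiffOn_det ?_)
  intro i j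
  simp only [Matrix.updateRow_apply]
  split_ifs
  · exact contDiffOn_const
  · exact hA i j

theorem sum_mul_sum_mul {ι : Type*} [Fintype ι] (p : ι → ℝ) (q : ι → ι → ℝ) (r : ι → ℝ) :
    ∑ e, p e * ∑ f, q e f * r f = ∑ f, (∑ e, p e * q e f) * r f := by
  simp only [Finset.mul_sum, Finset.sum_mul]
  rw [Finset.sum_comm]
  exact Finset.sum_congr rfl fun _ _ => Finset.sum_congr rfl fun _ _ => by ring

theorem riemann_antisymm_right (G : EuclideanSpace ℝ (Fin n) → Matrix (Fin n) (Fin n) ℝ)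
    (y : EuclideanSpace ℝ (Fin n)) (a b c d : Fin n) :
    riemann G a b c d y = -riemann G a b d c y := by
  simp only [riemann, riemannUp, ← Finset.sum_neg_distrib, ← mul_neg]
  refine Finset.sum_congr rfl fun e _ => ?_
  congr 1
  simp only [Finset.sum_sub_distrib]
  ring

theorem weyl_antisymm_right (G : EuclideanSpace ℝ (Fin n) → Matrix (Fin n) (Fin n) ℝ)
    (y : EuclideanSpace ℝ (Fin n)) (a b c d : Fin n) :
    weyl G a b c d y = -weyl G a b d c y := by
  simp only [weyl]
  rw [riemann_antisymm_right G]
  ring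

namespace IsMetricOn

variable {G : EuclideanSpace ℝ (Fin n) → Matrix (Fin n) (Fin n) ℝ} (hG : IsMetricOn G Ω)
include hG

theorem contDiffOn_inv (a b : Fin n) : ContDiffOn ℝ ∞ (fun y => (G y)⁻¹ a b) Ω :=
  Coord.contDiffOn_inv hG.smooth hG.isUnit_det a b

theorem inv_symm (y : EuclideanSpace ℝ (Fin n)) (a b : Fin n) : (G y)⁻¹ a b = (G y)⁻¹ b a := by
  have h : (G y).IsSymm := Matrix.IsSymm.ext fun i j => hG.symm y j i
  have h2 : ((G y)⁻¹).transpose = (G y)⁻¹ := by rw [Matrix.transpose_nonsing_inv, h.eq]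
  exact (congrFun (congrFun h2 a) b).symm

theorem sum_mul_inv {y : EuclideanSpace ℝ (Fin n)} (hy : y ∈ Ω) (a c : Fin n) :
    ∑ b, G y a b * (G y)⁻¹ b c = if a = c then 1 else 0 := by
  rw [← Matrix.mul_apply, Matrix.mul_nonsing_inv _ (hG.isUnit_det y hy), Matrix.one_apply]

theorem sum_inv_mul {y : EuclideanSpace ℝ (Fin n)} (hy : y ∈ Ω) (a c : Fin n) :
    ∑ b, (G y)⁻¹ a b * G y b c = if a = c then 1 else 0 := by
  rw [← Matrix.mul_apply, Matrix.nonsing_inv_mul _ (hG.isUnit_det y hy), Matrix.one_apply]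

theorem contDiffOn_christoffel (a b c : Fin n) : ContDiffOn ℝ ∞ (christoffel G a b c) Ω :=
  contDiffOn_const.mul (ContDiffOn.sum fun e _ => (hG.contDiffOn_inv a e).mul
    (((contDiffOn_pd hG.isOpen (hG.smooth e c)).add (contDiffOn_pd hG.isOpen (hG.smooth e b))).sub
      (contDiffOn_pd hG.isOpen (hG.smooth b c))))

theorem christoffel_symm (a b c : Fin n) (y : EuclideanSpace ℝ (Fin n)) :
    christoffel G a b c y = christoffel G a c b y := by
  simp only [christoffel]
  congr 1
  refine Finset.sum_congr rfl fun e _ => ?_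
  rw [show (fun z => G z b c) = fun z => G z c b from funext fun z => hG.symm z b c]
  ring

/-- The Christoffel symbols with all indices down, `Γ_{abc} = g_{ae} Γ^e_{bc}`. -/
theorem sum_mul_christoffel {y : EuclideanSpace ℝ (Fin n)} (hy : y ∈ Ω) (a b c : Fin n) :
    ∑ e, G y a e * christoffel G e b c y
      = (1 / 2) * (pd b (fun z => G z a c) y + pd c (fun z => G z a b) y
        - pd a (fun z => G z b c) y) := by
  have h : ∀ t : Fin n → ℝ, ∑ e, G y a e * ((1 / 2) * ∑ f, (G y)⁻¹ e f * t f) = (1 / 2) * t a := by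
    intro t
    calc ∑ e, G y a e * ((1 / 2) * ∑ f, (G y)⁻¹ e f * t f)
        = ∑ f, (1 / 2) * ((∑ e, G y a e * (G y)⁻¹ e f) * t f) := by
          simp only [Finset.mul_sum, Finset.sum_mul]
          rw [Finset.sum_comm]
          exact Finset.sum_congr rfl fun _ _ => Finset.sum_congr rfl fun _ _ => by ring
      _ = (1 / 2) * t a := by simp [hG.sum_mul_inv hy]
  exact h fun f => pd b (fun z => G z f c) y + pd c (fun z => G z f b) y - pd f (fun z => G z b c) y

theorem pd_metric {y : EuclideanSpace ℝ (Fin n)} (hy : y ∈ Ω) (a b c : Fin n) :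
    pd c (fun z => G z a b) y
      = ∑ e, G y a e * christoffel G e c b y + ∑ e, G y b e * christoffel G e c a y := by
  rw [hG.sum_mul_christoffel hy, hG.sum_mul_christoffel hy]
  rw [show (fun z => G z b a) = fun z => G z a b from funext fun z => hG.symm z b a,
    show (fun z => G z b c) = fun z => G z c b from funext fun z => hG.symm z b c,
    show (fun z => G z a c) = fun z => G z c a from funext fun z => hG.symm z a c]
  ring

/-- `g_{ef} Γ^e_{ab} Γ^f_{cd}` is symmetric under the exchange of the two index pairs. -/
theorem christoffel_quadratic_symm (y : EuclideanSpace ℝ (Fin n)) (a b c d : Fin n) :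
    ∑ e, (∑ f, G y e f * christoffel G f a b y) * christoffel G e c d y
      = ∑ e, (∑ f, G y e f * christoffel G f c d y) * christoffel G e a b y := by
  simp only [Finset.sum_mul]
  rw [Finset.sum_comm]
  refine Finset.sum_congr rfl fun _ _ => Finset.sum_congr rfl fun _ _ => ?_
  rw [hG.symm]
  ring

/-- The curvature tensor in terms of second derivatives of the metric:
`R_{abcd} = (∂_c∂_b g_{ad} - ∂_c∂_a g_{db} - ∂_d∂_b g_{ac} + ∂_d∂_a g_{cb}) / 2
+ g_{ef} (Γ^e_{da} Γ^f_{cb} - Γ^e_{ca} Γ^f_{db})`. -/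
theorem riemann_eq {y : EuclideanSpace ℝ (Fin n)} (hy : y ∈ Ω) (a b c d : Fin n) :
    riemann G a b c d y
      = (1 / 2) * (pd c (pd b fun z => G z a d) y - pd c (pd a fun z => G z d b) y
          - pd d (pd b fun z => G z a c) y + pd d (pd a fun z => G z c b) y)
        + (∑ e, (∑ f, G y e f * christoffel G f d a y) * christoffel G e c b y
          - ∑ e, (∑ f, G y e f * christoffel G f c a y) * christoffel G e d b y) := by
  -- lowering the index under the derivative sign costs terms quadratic in the Christoffel symbols
  have key : ∀ c d, ∑ e, G y a e * pd c (christoffel G e d b) y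
      = (1 / 2) * (pd c (pd d fun z => G z a b) y + pd c (pd b fun z => G z a d) y
          - pd c (pd a fun z => G z d b) y)
        - ∑ e, ((∑ f, G y a f * christoffel G f c e y)
          + ∑ f, G y e f * christoffel G f c a y) * christoffel G e d b y := by
    intro c d
    have h1 : pd c (fun z => ∑ e, G z a e * christoffel G e d b z) y
        = pd c (fun z => (1 / 2) * (pd d (fun z => G z a b) z + pd b (fun z => G z a d) z
        - pd a (fun z => G z d b) z)) y :=
      pd_congr hG.isOpen (fun z hz => hG.sum_mul_christoffel hz a d b) hy
    have hd : ∀ i j k, DifferentiableAt ℝ (fun z => pd i (fun z => G z j k) z) y := fun i j k =>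
      differentiableAt_of_contDiffOn hG.isOpen (contDiffOn_pd hG.isOpen (hG.smooth j k)) hy
    have hg : ∀ j k, DifferentiableAt ℝ (fun z => G z j k) y := fun j k =>
      differentiableAt_of_contDiffOn hG.isOpen (hG.smooth j k) hy
    have hc : ∀ i j k, DifferentiableAt ℝ (christoffel G i j k) y := fun i j k =>
      differentiableAt_of_contDiffOn hG.isOpen (hG.contDiffOn_christoffel i j k) hy
    rw [pd_const_mul (((hd _ _ _).fun_add (hd _ _ _)).fun_sub (hd _ _ _)),
      pd_sub ((hd _ _ _).fun_add (hd _ _ _)) (hd _ _ _), pd_add (hd _ _ _) (hd _ _ _),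
      pd_sum fun e _ => (hg a e).fun_mul (hc e d b)] at h1
    simp only [pd_mul (hg a _) (hc _ d b), Finset.sum_add_distrib, hG.pd_metric hy] at h1
    rw [← h1]
    ring
  have hexp : riemann G a b c d y = ∑ e, G y a e * pd c (christoffel G e d b) y
      - ∑ e, G y a e * pd d (christoffel G e c b) y
      + (∑ e, G y a e * ∑ f, christoffel G e c f y * christoffel G f d b y
        - ∑ e, G y a e * ∑ f, christoffel G e d f y * christoffel G f c b y) := by
    simp only [riemann, riemannUp, mul_add, mul_sub, Finset.sum_add_distrib,
      Finset.sum_sub_distrib]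
  rw [hexp, key, key, sum_mul_sum_mul, sum_mul_sum_mul,
    pd_comm hG.isOpen (hG.smooth a b) hy (k := d) (l := c)]
  simp only [add_mul, Finset.sum_add_distrib]
  ring

theorem riemann_pair_symm {y : EuclideanSpace ℝ (Fin n)} (hy : y ∈ Ω) (a b c d : Fin n) :
    riemann G a b c d y = riemann G c d a b y := by
  have hs : ∀ a b, (fun z => G z a b) = fun z => G z b a := fun a b => funext fun z => hG.symm z a b
  rw [hG.riemann_eq hy a b c d, hG.riemann_eq hy c d a b]
  rw [hG.christoffel_quadratic_symm y d a c b]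
  simp only [hG.christoffel_symm _ b c, hG.christoffel_symm _ a d, hG.christoffel_symm _ b d,
    hG.christoffel_symm _ a c]
  rw [pd_comm hG.isOpen (hG.smooth a d) hy (k := c) (l := b),
    pd_comm hG.isOpen (hG.smooth d b) hy (k := c) (l := a),
    pd_comm hG.isOpen (hG.smooth a c) hy (k := d) (l := b),
    pd_comm hG.isOpen (hG.smooth c b) hy (k := d) (l := a), hs a d, hs d b, hs a c, hs c b]
  ring

theorem riemann_antisymm_left {y : EuclideanSpace ℝ (Fin n)} (hy : y ∈ Ω) (a b c d : Fin n) :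
    riemann G a b c d y = -riemann G b a c d y := by
  rw [hG.riemann_pair_symm hy, riemann_antisymm_right G, hG.riemann_pair_symm hy]

theorem ricci_eq {y : EuclideanSpace ℝ (Fin n)} (hy : y ∈ Ω) (b d : Fin n) :
    ricci G b d y = ∑ a, ∑ e, (G y)⁻¹ a e * riemann G e b a d y := by
  simp only [ricci, riemann]
  refine Finset.sum_congr rfl fun a _ => ?_
  rw [sum_mul_sum_mul (fun e => (G y)⁻¹ a e) (fun e f => G y e f)]
  simp [hG.sum_inv_mul hy]

theorem ricci_symm {y : EuclideanSpace ℝ (Fin n)} (hy : y ∈ Ω) (b d : Fin n) :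
    ricci G b d y = ricci G d b y := by
  rw [hG.ricci_eq hy, hG.ricci_eq hy, Finset.sum_comm]
  refine Finset.sum_congr rfl fun a _ => Finset.sum_congr rfl fun e _ => ?_
  rw [hG.riemann_pair_symm hy, hG.inv_symm]

theorem weyl_pair_symm {y : EuclideanSpace ℝ (Fin n)} (hy : y ∈ Ω) (a b c d : Fin n) :
    weyl G a b c d y = weyl G c d a b y := by
  simp only [weyl]
  rw [hG.riemann_pair_symm hy a b c d, hG.symm y a c, hG.symm y a d, hG.symm y b c, hG.symm y b d,
    hG.ricci_symm hy b d, hG.ricci_symm hy b c, hG.ricci_symm hy a d, hG.ricci_symm hy a c]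
  ring

end IsMetricOn

end Coord

/-! ### Shear-free and twist-free observers are purely electric -/

namespace Coord

variable {n : ℕ} {Ω : Set (EuclideanSpace ℝ (Fin n))}

/-- `G` and `U` are the components on `Ω` of a smooth metric and of a smooth vector field with
`g(u, u) = -1`. -/
structure IsObserverOn (G : EuclideanSpace ℝ (Fin n) → Matrix (Fin n) (Fin n) ℝ)
    (U : EuclideanSpace ℝ (Fin n) → Fin n → ℝ) (Ω : Set (EuclideanSpace ℝ (Fin n))) : Prop
    extends IsMetricOn G Ω where
  smooth_vec : ∀ a, ContDiffOn ℝ ∞ (fun y => U y a) Ω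
  unit : ∀ y ∈ Ω, ∑ a, lower G U a y * U y a = -1

/-- The acceleration `u^d ∇_d u_a`. -/
noncomputable def acceleration (G : EuclideanSpace ℝ (Fin n) → Matrix (Fin n) (Fin n) ℝ)
    (U : EuclideanSpace ℝ (Fin n) → Fin n → ℝ) (a : Fin n) (y : EuclideanSpace ℝ (Fin n)) : ℝ :=
  ∑ d, U y d * covDeriv G U d a y

theorem sum_projMix_mul (G : EuclideanSpace ℝ (Fin n) → Matrix (Fin n) (Fin n) ℝ)
    (U : EuclideanSpace ℝ (Fin n) → Fin n → ℝ) (y : EuclideanSpace ℝ (Fin n)) (a : Fin n)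
    (t : Fin n → ℝ) :
    ∑ c, projMix G U a c y * t c = t a + lower G U a y * ∑ c, U y c * t c := by
  simp only [projMix, add_mul, Finset.sum_add_distrib, Finset.mul_sum]
  simp [mul_assoc]

namespace IsObserverOn

variable {G : EuclideanSpace ℝ (Fin n) → Matrix (Fin n) (Fin n) ℝ}
  {U : EuclideanSpace ℝ (Fin n) → Fin n → ℝ} (h : IsObserverOn G U Ω)
include h

theorem contDiffOn_lower (a : Fin n) : ContDiffOn ℝ ∞ (lower G U a) Ω :=
  ContDiffOn.sum fun b _ => (h.smooth a b).mul (h.smooth_vec b)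

theorem contDiffOn_covDeriv (b a : Fin n) : ContDiffOn ℝ ∞ (covDeriv G U b a) Ω :=
  (contDiffOn_pd h.isOpen (h.contDiffOn_lower a)).sub
    (ContDiffOn.sum fun c _ => (h.contDiffOn_christoffel c b a).mul (h.contDiffOn_lower c))

theorem contDiffOn_acceleration (a : Fin n) : ContDiffOn ℝ ∞ (acceleration G U a) Ω :=
  ContDiffOn.sum fun d _ => (h.smooth_vec d).mul (h.contDiffOn_covDeriv d a)

theorem contDiffOn_expansion : ContDiffOn ℝ ∞ (expansion G U) Ω :=
  ContDiffOn.sum fun a _ => ContDiffOn.sum fun b _ =>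
    (h.contDiffOn_inv a b).mul (h.contDiffOn_covDeriv b a)

/-- `u^a ∇_b u_a = 0`, because `g(u, u)` is constant. -/
theorem sum_covDeriv_mul {y : EuclideanSpace ℝ (Fin n)} (hy : y ∈ Ω) (b : Fin n) :
    ∑ a, covDeriv G U b a y * U y a = 0 := by
  have hU : ∀ a, DifferentiableAt ℝ (fun z => U z a) y := fun a =>
    differentiableAt_of_contDiffOn h.isOpen (h.smooth_vec a) hy
  have hL : ∀ a, DifferentiableAt ℝ (lower G U a) y := fun a =>
    differentiableAt_of_contDiffOn h.isOpen (h.contDiffOn_lower a) hy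
  have hg : ∀ a c, DifferentiableAt ℝ (fun z => G z a c) y := fun a c =>
    differentiableAt_of_contDiffOn h.isOpen (h.smooth a c) hy
  have h1 : ∑ a, (pd b (lower G U a) y * U y a + lower G U a y * pd b (fun z => U z a) y) = 0 := by
    have := pd_congr (k := b) h.isOpen (fun z hz => h.unit z hz) hy
    rw [pd_const, pd_sum fun a _ => (hL a).fun_mul (hU a)] at this
    simpa only [pd_mul (hL _) (hU _)] using this
  have h2 : ∀ a, pd b (lower G U a) y
      = ∑ c, (pd b (fun z => G z a c) y * U y c + G y a c * pd b (fun z => U z c) y) := by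
    intro a
    show pd b (fun z => ∑ c, G z a c * U z c) y = _
    rw [pd_sum fun c _ => (hg a c).fun_mul (hU c)]
    simp only [pd_mul (hg a _) (hU _)]
  have h3 : ∑ a, lower G U a y * pd b (fun z => U z a) y
      = ∑ a, (∑ c, G y a c * pd b (fun z => U z c) y) * U y a := by
    simp only [lower, Finset.sum_mul]
    rw [Finset.sum_comm]
    refine Finset.sum_congr rfl fun a _ => Finset.sum_congr rfl fun c _ => ?_
    rw [h.symm y c a]
    ring
  have h4 : ∑ a, (∑ c, christoffel G c b a y * lower G U c y) * U y a
      = ∑ a, ∑ c, (∑ e, G y c e * christoffel G e b a y) * (U y c * U y a) := by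
    refine Finset.sum_congr rfl fun a _ => ?_
    simp only [lower, Finset.sum_mul, Finset.mul_sum]
    rw [Finset.sum_comm]
    refine Finset.sum_congr rfl fun c _ => Finset.sum_congr rfl fun e _ => ?_
    rw [h.symm y c e]
    ring
  have h5 : ∑ a, (∑ c, pd b (fun z => G z a c) y * U y c) * U y a
      = 2 * ∑ a, ∑ c, (∑ e, G y c e * christoffel G e b a y) * (U y c * U y a) := by
    simp only [h.pd_metric hy, add_mul, Finset.sum_add_distrib, two_mul]
    congr 1
    · simp only [Finset.sum_mul]
      rw [Finset.sum_comm]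
      refine Finset.sum_congr rfl fun a _ => Finset.sum_congr rfl fun a _ =>
        Finset.sum_congr rfl fun a _ => by ring
    · simp only [Finset.sum_mul]
      refine Finset.sum_congr rfl fun a _ => Finset.sum_congr rfl fun a _ =>
        Finset.sum_congr rfl fun a _ => by ring
  simp only [Finset.sum_add_distrib] at h1 h2
  simp only [covDeriv, sub_mul, Finset.sum_sub_distrib, h4]
  rw [h3] at h1
  simp only [h2, add_mul, Finset.sum_add_distrib, h5] at h1 ⊢
  linarith

/-- Only the index of differentiation needs to be projected, since `u^a ∇_b u_a = 0`. -/
theorem spatialDeriv_eq {y : EuclideanSpace ℝ (Fin n)} (hy : y ∈ Ω) (a b : Fin n) :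
    spatialDeriv G U a b y
      = covDeriv G U b a y + lower G U b y * acceleration G U a y := by
  have h0 : ∀ d, ∑ c, projMix G U a c y * covDeriv G U d c y = covDeriv G U d a y := by
    intro d
    rw [sum_projMix_mul]
    have := h.sum_covDeriv_mul hy d
    simp only [mul_comm (U y _), this]
    ring
  have h1 : spatialDeriv G U a b y
      = ∑ d, projMix G U b d y * ∑ c, projMix G U a c y * covDeriv G U d c y := by
    simp only [spatialDeriv, Finset.mul_sum]
    rw [Finset.sum_comm]
    exact Finset.sum_congr rfl fun _ _ => Finset.sum_congr rfl fun _ _ => by ring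
  rw [h1]
  simp only [h0]
  rw [sum_projMix_mul]
  rfl

/-- Without shear and twist, `∇_b u_a = θ h_{ab} / (n - 1) - u_b (u^d ∇_d u_a)`. -/
theorem covDeriv_eq {y : EuclideanSpace ℝ (Fin n)} (hy : y ∈ Ω)
    (hσ : ∀ a b, shear G U a b y = 0) (hω : ∀ a b, twist G U a b y = 0) (a b : Fin n) :
    covDeriv G U b a y = expansion G U y / ((n : ℝ) - 1) * proj G U a b y
      - lower G U b y * acceleration G U a y := by
  have h1 := hσ a b
  have h2 := hω a b
  have h3 := h.spatialDeriv_eq hy a b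
  simp only [shear, twist] at h1 h2
  linarith

/-- The Ricci identity `∇_c ∇_d u_b - ∇_d ∇_c u_b = - R_{abcd} u^a`. -/
theorem ricci_identity {y : EuclideanSpace ℝ (Fin n)} (hy : y ∈ Ω) (b c d : Fin n) :
    ∑ a, riemann G a b c d y * U y a
      = -(pd c (covDeriv G U d b) y - ∑ e, christoffel G e c b y * covDeriv G U d e y
        - (pd d (covDeriv G U c b) y - ∑ e, christoffel G e d b y * covDeriv G U c e y)) := by
  have hL : ∀ a, DifferentiableAt ℝ (lower G U a) y := fun a =>
    differentiableAt_of_contDiffOn h.isOpen (h.contDiffOn_lower a) hy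
  have hC : ∀ i j k, DifferentiableAt ℝ (christoffel G i j k) y := fun i j k =>
    differentiableAt_of_contDiffOn h.isOpen (h.contDiffOn_christoffel i j k) hy
  have hdL : ∀ a c, DifferentiableAt ℝ (pd c (lower G U a)) y := fun a c =>
    differentiableAt_of_contDiffOn h.isOpen (contDiffOn_pd h.isOpen (h.contDiffOn_lower a)) hy
  have h1 : ∀ c d, pd c (covDeriv G U d b) y = pd c (pd d (lower G U b)) y
      - (∑ e, pd c (christoffel G e d b) y * lower G U e y
        + ∑ e, christoffel G e d b y * pd c (lower G U e) y) := by
    intro c d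
    show pd c (fun z => pd d (lower G U b) z - ∑ e, christoffel G e d b z * lower G U e z) y = _
    rw [pd_sub (hdL _ _) (DifferentiableAt.fun_sum fun e _ => (hC e d b).fun_mul (hL e)),
      pd_sum fun e _ => (hC e d b).fun_mul (hL e)]
    simp only [pd_mul (hC _ d b) (hL _), Finset.sum_add_distrib]
  have h2 : ∑ a, riemann G a b c d y * U y a = ∑ e, riemannUp G e b c d y * lower G U e y := by
    simp only [riemann, lower, Finset.sum_mul, Finset.mul_sum]
    rw [Finset.sum_comm]
    refine Finset.sum_congr rfl fun e _ => Finset.sum_congr rfl fun a _ => ?_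
    rw [h.symm y a e]
    ring
  have h3 : ∀ c d, ∑ e, (∑ f, christoffel G e c f y * christoffel G f d b y) * lower G U e y
      = ∑ f, christoffel G f d b y * ∑ e, christoffel G e c f y * lower G U e y := by
    intro c d
    simp only [Finset.sum_mul, Finset.mul_sum]
    rw [Finset.sum_comm]
    exact Finset.sum_congr rfl fun _ _ => Finset.sum_congr rfl fun _ _ => by ring
  have h4 : ∀ c d, ∑ e, christoffel G e c b y * covDeriv G U d e y
      = ∑ e, christoffel G e c b y * pd d (lower G U e) y
        - ∑ e, christoffel G e c b y * ∑ f, christoffel G f d e y * lower G U f y := by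
    intro c d
    simp only [covDeriv, mul_sub, Finset.sum_sub_distrib]
  rw [h2, h1 c d, h1 d c, h4 c d, h4 d c, pd_comm h.isOpen (h.contDiffOn_lower b) hy (k := c)]
  simp only [riemannUp, add_mul, sub_mul, Finset.sum_add_distrib, Finset.sum_sub_distrib, h3]
  ring

/-- The curvature contracted with a shear-free, twist-free observer: the part with all three free
indices spatial is pure trace, with coefficient the gradient of the expansion. The Ricci identity
splits off this part, since every other term carries a factor `u_c` or `u_d`. -/
theorem exists_sum_riemann_mul_eq {y : EuclideanSpace ℝ (Fin n)} (hy : y ∈ Ω)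
    (hσ : ∀ z ∈ Ω, ∀ a b, shear G U a b z = 0) (hω : ∀ z ∈ Ω, ∀ a b, twist G U a b z = 0) :
    ∃ (p : Fin n → ℝ) (L : Fin n → Fin n → ℝ), ∀ b c d,
      ∑ a, riemann G a b c d y * U y a = p c * proj G U d b y - p d * proj G U c b y
        + lower G U c y * L d b - lower G U d y * L c b := by
  set f : EuclideanSpace ℝ (Fin n) → ℝ := fun z => expansion G U z / ((n : ℝ) - 1) with hf
  have hfs : ContDiffOn ℝ ∞ f Ω := h.contDiffOn_expansion.div_const _
  have hfd : DifferentiableAt ℝ f y := differentiableAt_of_contDiffOn h.isOpen hfs hy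
  have hL : ∀ a, DifferentiableAt ℝ (lower G U a) y := fun a =>
    differentiableAt_of_contDiffOn h.isOpen (h.contDiffOn_lower a) hy
  have hg : ∀ a c, DifferentiableAt ℝ (fun z => G z a c) y := fun a c =>
    differentiableAt_of_contDiffOn h.isOpen (h.smooth a c) hy
  have hA : ∀ a, DifferentiableAt ℝ (acceleration G U a) y := fun a =>
    differentiableAt_of_contDiffOn h.isOpen (h.contDiffOn_acceleration a) hy
  have hB : ∀ d b, ∀ z ∈ Ω, covDeriv G U d b z
      = f z * (G z b d + lower G U b z * lower G U d z)
        - lower G U d z * acceleration G U b z :=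
    fun d b z hz => h.covDeriv_eq hz (hσ z hz) (hω z hz) b d
  have hdL : ∀ c d, pd c (lower G U d) y
      = covDeriv G U c d y + ∑ e, christoffel G e c d y * lower G U e y := fun c d => by
    simp only [covDeriv]; ring
  have hpd : ∀ c d b, pd c (covDeriv G U d b) y
      = pd c f y * (G y b d + lower G U b y * lower G U d y)
        + f y * (pd c (fun z => G z b d) y + (pd c (lower G U b) y * lower G U d y
          + lower G U b y * pd c (lower G U d) y))
        - (pd c (lower G U d) y * acceleration G U b y
          + lower G U d y * pd c (acceleration G U b) y) := by
    intro c d b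
    rw [pd_congr h.isOpen (hB d b) hy,
      pd_sub (hfd.fun_mul ((hg _ _).fun_add ((hL _).fun_mul (hL _)))) ((hL _).fun_mul (hA _)),
      pd_mul hfd ((hg _ _).fun_add ((hL _).fun_mul (hL _))),
      pd_add (hg _ _) ((hL _).fun_mul (hL _)), pd_mul (hL _) (hL _), pd_mul (hL _) (hA _)]
  have hΓB : ∀ c d b, ∑ e, christoffel G e c b y * covDeriv G U d e y
      = f y * (∑ e, G y d e * christoffel G e c b y
          + lower G U d y * ∑ e, christoffel G e c b y * lower G U e y)
        - lower G U d y * ∑ e, christoffel G e c b y * acceleration G U e y := by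
    intro c d b
    simp only [hB d _ y hy, Finset.mul_sum, ← Finset.sum_add_distrib, ← Finset.sum_sub_distrib]
    refine Finset.sum_congr rfl fun e _ => ?_
    rw [h.symm y e d]
    ring
  -- `∇_c u_d - ∇_d u_c` and the acceleration terms carry a factor `u_c` or `u_d`
  refine ⟨fun c => -pd c f y, fun d b => f y * acceleration G U d y * lower G U b y
      + f y * covDeriv G U d b y - acceleration G U d y * acceleration G U b y
      - (pd d (acceleration G U b) y - ∑ e, christoffel G e d b y * acceleration G U e y),
    fun b c d => ?_⟩
  rw [h.ricci_identity hy]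
  simp only [hpd, hΓB, hdL, h.pd_metric hy, proj]
  rw [h.symm y b d, h.symm y b c]
  simp only [h.christoffel_symm _ d c]
  rw [hB c d y hy, hB d c y hy, h.symm y d c]
  ring

end IsObserverOn

end Coord

namespace Coord

variable {n : ℕ} {Ω : Set (EuclideanSpace ℝ (Fin n))}

namespace IsObserverOn

variable {G : EuclideanSpace ℝ (Fin n) → Matrix (Fin n) (Fin n) ℝ}
  {U : EuclideanSpace ℝ (Fin n) → Fin n → ℝ} (h : IsObserverOn G U Ω)
include h

theorem sum_inv_mul_lower {y : EuclideanSpace ℝ (Fin n)} (hy : y ∈ Ω) (a : Fin n) :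
    ∑ b, (G y)⁻¹ a b * lower G U b y = U y a := by
  simp only [lower]
  rw [sum_mul_sum_mul (fun b => (G y)⁻¹ a b) (fun b c => G y b c)]
  simp [h.sum_inv_mul hy]

theorem sum_projUp_mul_lower {y : EuclideanSpace ℝ (Fin n)} (hy : y ∈ Ω) (a : Fin n) :
    ∑ b, projUp G U a b y * lower G U b y = 0 := by
  simp only [projUp, add_mul, Finset.sum_add_distrib, h.sum_inv_mul_lower hy]
  have h1 : ∑ b, U y a * U y b * lower G U b y = U y a * ∑ b, lower G U b y * U y b := by
    rw [Finset.mul_sum]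
    exact Finset.sum_congr rfl fun _ _ => by ring
  rw [h1, h.unit y hy]
  ring

theorem sum_proj_mul {y : EuclideanSpace ℝ (Fin n)} (hy : y ∈ Ω) (a : Fin n) :
    ∑ b, proj G U a b y * U y b = 0 := by
  simp only [proj, add_mul, Finset.sum_add_distrib, mul_assoc, ← Finset.mul_sum, h.unit y hy]
  simp [lower]

theorem proj_symm (y : EuclideanSpace ℝ (Fin n)) (a b : Fin n) :
    proj G U a b y = proj G U b a y := by
  simp only [proj]
  rw [h.symm y a b]
  ring

theorem sum_inv_mul_proj {y : EuclideanSpace ℝ (Fin n)} (hy : y ∈ Ω) (a c : Fin n) :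
    ∑ b, (G y)⁻¹ a b * proj G U b c y = (if a = c then 1 else 0) + U y a * lower G U c y := by
  simp only [proj, mul_add, Finset.sum_add_distrib, h.sum_inv_mul hy]
  simp only [← mul_assoc, ← Finset.sum_mul, h.sum_inv_mul_lower hy]

/-- The Ricci tensor contracted once with the observer, when the curvature has the form that holds
without shear and twist: `R_{fk} u^k` is `(n - 2) p_f` up to a multiple of `u_f`. -/
theorem exists_sum_ricci_mul_eq {y : EuclideanSpace ℝ (Fin n)} (hy : y ∈ Ω)
    {p : Fin n → ℝ} {L : Fin n → Fin n → ℝ}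
    (hR : ∀ b c d, ∑ a, riemann G a b c d y * U y a = p c * proj G U d b y - p d * proj G U c b y
        + lower G U c y * L d b - lower G U d y * L c b) :
    ∃ s : ℝ, ∀ f, ∑ k, ricci G f k y * U y k = ((n : ℝ) - 2) * p f + lower G U f y * s := by
  set m : Fin n → ℝ := fun d => ∑ b, L d b * U y b with hm
  have hm1 : ∀ c d, lower G U c y * m d = lower G U d y * m c := by
    intro c d
    -- `R_{abcd} u^a u^b = 0`
    have h1 : ∑ b, (∑ a, riemann G a b c d y * U y a) * U y b = 0 := by
      have h2 : ∑ b, (∑ a, riemann G a b c d y * U y a) * U y b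
          = -∑ b, (∑ a, riemann G a b c d y * U y a) * U y b := by
        simp only [Finset.sum_mul]
        conv_lhs => rw [Finset.sum_comm]
        rw [← Finset.sum_neg_distrib]
        refine Finset.sum_congr rfl fun a _ => ?_
        rw [← Finset.sum_neg_distrib]
        refine Finset.sum_congr rfl fun b _ => ?_
        rw [h.riemann_antisymm_left hy]
        ring
      linarith
    have h3 : ∀ (c d : Fin n) (t : ℝ), ∑ b, t * proj G U d b y * U y b = 0 := by
      intro c d t
      simp only [mul_assoc, ← Finset.mul_sum, h.sum_proj_mul hy, mul_zero]
    have h4 : ∀ c d, ∑ b, lower G U c y * L d b * U y b = lower G U c y * m d := by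
      intro c d
      simp only [mul_assoc, ← Finset.mul_sum, hm]
    simp only [hR, add_mul, sub_mul, Finset.sum_add_distrib, Finset.sum_sub_distrib, h3 c, h4] at h1
    linarith
  -- contracting `u_c m_d = u_d m_c` with `u^c` shows that `m` is proportional to `u`
  have hm2 : ∀ d, m d = -(lower G U d y * ∑ c, m c * U y c) := by
    intro d
    have h1 : ∑ c, lower G U c y * m d * U y c = ∑ c, lower G U d y * m c * U y c := by
      simp only [hm1 _ d]
    have h2 : ∑ c, lower G U c y * m d * U y c = m d * ∑ c, lower G U c y * U y c := by
      rw [Finset.mul_sum]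
      exact Finset.sum_congr rfl fun _ _ => by ring
    rw [h2, h.unit y hy] at h1
    simp only [mul_assoc, ← Finset.mul_sum] at h1
    linarith
  have hric : ∀ f, ∑ k, ricci G f k y * U y k
      = -∑ a, ∑ e, (G y)⁻¹ a e * (p e * proj G U f a y - p f * proj G U e a y
        + lower G U e y * L f a - lower G U f y * L e a) := by
    intro f
    simp only [← hR, h.ricci_eq hy, Finset.sum_mul, Finset.mul_sum]
    rw [Finset.sum_comm, ← Finset.sum_neg_distrib]
    refine Finset.sum_congr rfl fun a _ => ?_
    rw [Finset.sum_comm, ← Finset.sum_neg_distrib]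
    refine Finset.sum_congr rfl fun e _ => ?_
    rw [← Finset.sum_neg_distrib]
    refine Finset.sum_congr rfl fun k _ => ?_
    rw [h.riemann_pair_symm hy, h.riemann_antisymm_left hy]
    ring
  have h1 : ∀ f, ∑ a, ∑ e, (G y)⁻¹ a e * (p e * proj G U f a y)
      = p f + lower G U f y * ∑ e, p e * U y e := by
    intro f
    rw [Finset.sum_comm]
    have : ∀ e, ∑ a, (G y)⁻¹ a e * (p e * proj G U f a y)
        = p e * ((if e = f then 1 else 0) + U y e * lower G U f y) := by
      intro e
      rw [← h.sum_inv_mul_proj hy, Finset.mul_sum]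
      refine Finset.sum_congr rfl fun a _ => ?_
      rw [h.inv_symm, h.proj_symm]
      ring
    simp only [this, mul_add, Finset.sum_add_distrib, Finset.mul_sum]
    congr 1
    · simp
    · exact Finset.sum_congr rfl fun _ _ => by ring
  have h2 : ∀ f, ∑ a, ∑ e, (G y)⁻¹ a e * (p f * proj G U e a y) = ((n : ℝ) - 1) * p f := by
    intro f
    have : ∀ a, ∑ e, (G y)⁻¹ a e * (p f * proj G U e a y)
        = p f * (1 + lower G U a y * U y a) := by
      intro a
      have := h.sum_inv_mul_proj hy a a
      rw [if_pos rfl] at this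
      rw [mul_comm (lower G U a y), ← this, Finset.mul_sum]
      exact Finset.sum_congr rfl fun _ _ => by ring
    simp only [this, ← Finset.mul_sum, Finset.sum_add_distrib, h.unit y hy]
    simp
    ring
  have h3 : ∀ f, ∑ a, ∑ e, (G y)⁻¹ a e * (lower G U e y * L f a) = m f := by
    intro f
    refine Finset.sum_congr rfl fun a _ => ?_
    simp only [← mul_assoc, ← Finset.sum_mul, h.sum_inv_mul_lower hy]
    ring
  have h4 : ∀ f, ∑ a, ∑ e, (G y)⁻¹ a e * (lower G U f y * L e a)
      = lower G U f y * ∑ a, ∑ e, (G y)⁻¹ a e * L e a := by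
    intro f
    simp only [Finset.mul_sum]
    exact Finset.sum_congr rfl fun _ _ => Finset.sum_congr rfl fun _ _ => by ring
  refine ⟨-(∑ e, p e * U y e) + ∑ c, m c * U y c + ∑ a, ∑ e, (G y)⁻¹ a e * L e a, fun f => ?_⟩
  rw [hric]
  simp only [mul_add, mul_sub, Finset.sum_add_distrib, Finset.sum_sub_distrib, h1, h2, h3, h4]
  rw [hm2]
  ring

/-- The Weyl tensor contracted once with a shear-free, twist-free observer has no part in which
both indices of the uncontracted pair are spatial: in forming the trace-free part of the curvature,
the gradient of the expansion cancels. -/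
theorem exists_sum_weyl_mul_eq (hn : 3 ≤ n) {y : EuclideanSpace ℝ (Fin n)} (hy : y ∈ Ω)
    (hσ : ∀ z ∈ Ω, ∀ a b, shear G U a b z = 0) (hω : ∀ z ∈ Ω, ∀ a b, twist G U a b z = 0) :
    ∃ Z : Fin n → Fin n → ℝ, ∀ e f c,
      ∑ k, weyl G e f k c y * U y k = lower G U e y * Z f c - lower G U f y * Z e c := by
  obtain ⟨p, L, hR⟩ := h.exists_sum_riemann_mul_eq hy hσ hω
  obtain ⟨s, hs⟩ := h.exists_sum_ricci_mul_eq hy hR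
  have hn2 : (n : ℝ) - 2 ≠ 0 := by
    have : (3 : ℝ) ≤ n := by exact_mod_cast hn
    linarith
  set S : ℝ := scalarCurv G y / (((n : ℝ) - 1) * ((n : ℝ) - 2)) with hS
  refine ⟨fun f c => L f c - 1 / ((n : ℝ) - 2) * (ricci G f c y + s * G y f c) + S * G y f c
    - p f * lower G U c y, fun e f c => ?_⟩
  have h1 : ∑ k, riemann G e f k c y * U y k = p e * proj G U f c y - p f * proj G U e c y
        + lower G U e y * L f c - lower G U f y * L e c := by
    rw [← hR]
    exact Finset.sum_congr rfl fun k _ => by rw [h.riemann_pair_symm hy]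
  have h2 : ∑ k, weyl G e f k c y * U y k = ∑ k, riemann G e f k c y * U y k
      - 1 / ((n : ℝ) - 2) * (lower G U e y * ricci G f c y - G y e c * ∑ k, ricci G f k y * U y k
        - lower G U f y * ricci G e c y + G y f c * ∑ k, ricci G e k y * U y k)
      + S * (lower G U e y * G y f c - G y e c * lower G U f y) := by
    simp only [weyl, lower, Finset.mul_sum, Finset.sum_mul, ← Finset.sum_add_distrib,
      ← Finset.sum_sub_distrib]
    refine Finset.sum_congr rfl fun k _ => ?_
    rw [← hS]
    ring
  rw [h2, h1, hs, hs]
  simp only [proj]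
  field_simp
  ring

/-- The contraction of `C^{bkef}` with `u_k`, in terms of that of the Weyl tensor. -/
theorem sum_lower_mul_weylUp {y : EuclideanSpace ℝ (Fin n)} (hy : y ∈ Ω)
    {Z : Fin n → Fin n → ℝ}
    (hZ : ∀ e f c, ∑ k, weyl G e f k c y * U y k = lower G U e y * Z f c - lower G U f y * Z e c)
    (b e f : Fin n) :
    ∑ k, lower G U k y * weylUp G b k e f y
      = U y f * (∑ b', ∑ e', (G y)⁻¹ b b' * (G y)⁻¹ e e' * Z e' b')
        - U y e * (∑ b', ∑ f', (G y)⁻¹ b b' * (G y)⁻¹ f f' * Z f' b') := by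
  have h1 : ∑ k, lower G U k y * weylUp G b k e f y
      = ∑ b', ∑ k', ∑ e', ∑ f', (∑ k, (G y)⁻¹ k' k * lower G U k y) *
        ((G y)⁻¹ b b' * (G y)⁻¹ e e' * (G y)⁻¹ f f' * weyl G b' k' e' f' y) := by
    simp only [weylUp, Finset.mul_sum, Finset.sum_mul]
    rw [Finset.sum_comm]
    refine Finset.sum_congr rfl fun b' _ => ?_
    rw [Finset.sum_comm]
    refine Finset.sum_congr rfl fun k' _ => ?_
    rw [Finset.sum_comm]
    refine Finset.sum_congr rfl fun e' _ => ?_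
    rw [Finset.sum_comm]
    refine Finset.sum_congr rfl fun f' _ => Finset.sum_congr rfl fun k _ => ?_
    rw [h.inv_symm y k' k]
    ring
  have h2 : ∑ k, lower G U k y * weylUp G b k e f y
      = ∑ b', ∑ e', ∑ f', (G y)⁻¹ b b' * (G y)⁻¹ e e' * (G y)⁻¹ f f' *
        -(∑ k, weyl G e' f' k b' y * U y k) := by
    rw [h1]
    simp only [h.sum_inv_mul_lower hy]
    refine Finset.sum_congr rfl fun b' _ => ?_
    rw [Finset.sum_comm]
    refine Finset.sum_congr rfl fun e' _ => ?_
    rw [Finset.sum_comm]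
    refine Finset.sum_congr rfl fun f' _ => ?_
    rw [← Finset.sum_neg_distrib, Finset.mul_sum]
    refine Finset.sum_congr rfl fun k _ => ?_
    rw [h.weyl_pair_symm hy, weyl_antisymm_right]
    ring
  rw [h2]
  simp only [hZ, Finset.mul_sum]
  have h3 : ∀ e, U y e = ∑ b, (G y)⁻¹ e b * lower G U b y := fun e =>
    (h.sum_inv_mul_lower hy e).symm
  rw [h3 e, h3 f]
  simp only [Finset.sum_mul, ← Finset.sum_sub_distrib]
  refine Finset.sum_congr rfl fun b' _ => ?_
  simp only [Finset.sum_sub_distrib]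
  conv_rhs => enter [2]; rw [Finset.sum_comm]
  simp only [← Finset.sum_sub_distrib]
  refine Finset.sum_congr rfl fun e' _ => ?_
  exact Finset.sum_congr rfl fun f' _ => by ring

/-- The magnetic part of the Weyl tensor with respect to a shear-free, twist-free observer
vanishes. -/
theorem weylMagnetic_eq_zero (hn : 3 ≤ n) {y : EuclideanSpace ℝ (Fin n)} (hy : y ∈ Ω)
    (hσ : ∀ z ∈ Ω, ∀ a b, shear G U a b z = 0) (hω : ∀ z ∈ Ω, ∀ a b, twist G U a b z = 0)
    (a b c d : Fin n) : weylMagnetic G U a b c d y = 0 := by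
  obtain ⟨Z, hZ⟩ := h.exists_sum_weyl_mul_eq hn hy hσ hω
  -- in the first half of the magnetic part both terms of `hZ` are projected along `u`
  have h1 : ∀ c, ∑ e, ∑ f, ∑ k, projUp G U a e y * projUp G U b f y * weyl G e f k c y * U y k
      = 0 := by
    intro c
    have : ∀ e f, ∑ k, projUp G U a e y * projUp G U b f y * weyl G e f k c y * U y k
        = (projUp G U a e y * lower G U e y) * (projUp G U b f y * Z f c)
          - (projUp G U a e y * Z e c) * (projUp G U b f y * lower G U f y) := by
      intro e f
      simp only [mul_assoc, ← Finset.mul_sum, hZ]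
      ring
    simp only [this, Finset.sum_sub_distrib, ← Finset.mul_sum, ← Finset.sum_mul,
      h.sum_projUp_mul_lower hy]
    ring
  -- likewise in the second half: each term of `C^{bkef} u_k` has a factor `u^e` or `u^f`
  have h2 : ∀ b, ∑ k, ∑ e, ∑ f, lower G U k y * weylUp G b k e f y * proj G U c e y *
      proj G U d f y = 0 := by
    intro b
    rw [Finset.sum_comm]
    have : ∀ e, ∑ k, ∑ f, lower G U k y * weylUp G b k e f y * proj G U c e y * proj G U d f y
        = ∑ f, (∑ k, lower G U k y * weylUp G b k e f y) * proj G U c e y * proj G U d f y := by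
      intro e
      rw [Finset.sum_comm]
      simp only [Finset.sum_mul]
    obtain ⟨Y, hY⟩ : ∃ Y : Fin n → ℝ, ∀ e f,
        ∑ k, lower G U k y * weylUp G b k e f y = U y f * Y e - U y e * Y f :=
      ⟨_, h.sum_lower_mul_weylUp hy hZ b⟩
    simp only [this, hY]
    have h3 : ∀ e f, (U y f * Y e - U y e * Y f) * proj G U c e y * proj G U d f y
        = (Y e * proj G U c e y) * (proj G U d f y * U y f)
          - (proj G U c e y * U y e) * (Y f * proj G U d f y) := fun e f => by ring
    simp only [h3, Finset.sum_sub_distrib, ← Finset.mul_sum, ← Finset.sum_mul, h.sum_proj_mul hy]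
    ring
  have e1 : ∑ e, ∑ f, ∑ k, projUp G U a e y * projUp G U b f y *
      ((weyl G e f k c y * lower G U d y - weyl G e f k d y * lower G U c y) / 2) * U y k
      = (lower G U d y / 2) * ∑ e, ∑ f, ∑ k,
          projUp G U a e y * projUp G U b f y * weyl G e f k c y * U y k
        - (lower G U c y / 2) * ∑ e, ∑ f, ∑ k,
          projUp G U a e y * projUp G U b f y * weyl G e f k d y * U y k := by
    simp only [Finset.mul_sum, ← Finset.sum_sub_distrib]
    exact Finset.sum_congr rfl fun _ _ => Finset.sum_congr rfl fun _ _ =>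
      Finset.sum_congr rfl fun _ _ => by ring
  have e2 : ∑ k, ∑ e, ∑ f, lower G U k y *
      ((U y a * weylUp G b k e f y - U y b * weylUp G a k e f y) / 2) *
      proj G U c e y * proj G U d f y
      = (U y a / 2) * ∑ k, ∑ e, ∑ f, lower G U k y * weylUp G b k e f y * proj G U c e y *
          proj G U d f y
        - (U y b / 2) * ∑ k, ∑ e, ∑ f, lower G U k y * weylUp G a k e f y * proj G U c e y *
          proj G U d f y := by
    simp only [Finset.mul_sum, ← Finset.sum_sub_distrib]
    exact Finset.sum_congr rfl fun _ _ => Finset.sum_congr rfl fun _ _ =>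
      Finset.sum_congr rfl fun _ _ => by ring
  rw [weylMagnetic, e1, e2, h1, h1, h2, h2]
  ring

end IsObserverOn

end Coord

/-! ### Components in a chart -/

namespace LorentzMetric

variable {d : ℕ} {M : Type*} [TopologicalSpace M]
  [ChartedSpace (EuclideanSpace ℝ (Fin (d + 1))) M]

/-- The components of a tangent vector in the chart `φ`. -/
noncomputable def tangentCoord (φ : OpenPartialHomeomorph M (EuclideanSpace ℝ (Fin (d + 1))))
    (p : M) : TangentSpace (𝓡 (d + 1)) p →L[ℝ] EuclideanSpace ℝ (Fin (d + 1)) :=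
  mfderiv (𝓡 (d + 1)) (𝓡 (d + 1)) φ p

theorem vecComp_eq (φ : OpenPartialHomeomorph M (EuclideanSpace ℝ (Fin (d + 1))))
    (u : (p : M) → TangentSpace (𝓡 (d + 1)) p) (y : EuclideanSpace ℝ (Fin (d + 1)))
    (a : Fin (d + 1)) :
    vecComp φ u y a = tangentCoord φ (φ.symm y) (u (φ.symm y)) a := rfl

theorem mdifferentiable_of_mem_maximalAtlas
    {φ : OpenPartialHomeomorph M (EuclideanSpace ℝ (Fin (d + 1)))}
    (hφ : φ ∈ IsManifold.maximalAtlas (𝓡 (d + 1)) ∞ M) :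
    φ.MDifferentiable (𝓡 (d + 1)) (𝓡 (d + 1)) :=
  ⟨(contMDiffOn_of_mem_maximalAtlas hφ).mdifferentiableOn (by simp),
    (contMDiffOn_symm_of_mem_maximalAtlas hφ).mdifferentiableOn (by simp)⟩

theorem tangentCoord_apply_vec {φ : OpenPartialHomeomorph M (EuclideanSpace ℝ (Fin (d + 1)))}
    (u : (p : M) → TangentSpace (𝓡 (d + 1)) p) {p : M} (hp : p ∈ φ.source) (a : Fin (d + 1)) :
    tangentCoord φ p (u p) a = vecComp φ u (φ p) a := by
  obtain ⟨y, hy, rfl⟩ : ∃ y ∈ φ.target, φ.symm y = p := ⟨φ p, φ.map_source hp, φ.left_inv hp⟩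
  rw [φ.right_inv hy]
  rfl

variable {φ : OpenPartialHomeomorph M (EuclideanSpace ℝ (Fin (d + 1)))}

theorem tangentCoord_coordVec (hφ : φ ∈ IsManifold.maximalAtlas (𝓡 (d + 1)) ∞ M)
    {y : EuclideanSpace ℝ (Fin (d + 1))} (hy : y ∈ φ.target) (i : Fin (d + 1)) :
    tangentCoord φ (φ.symm y) (coordVec φ y i) = EuclideanSpace.single i 1 :=
  DFunLike.congr_fun ((mdifferentiable_of_mem_maximalAtlas hφ).comp_symm_deriv hy)
    (EuclideanSpace.single i (1 : ℝ))

theorem tangentCoord_injective (hφ : φ ∈ IsManifold.maximalAtlas (𝓡 (d + 1)) ∞ M)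
    {p : M} (hp : p ∈ φ.source) : Function.Injective (tangentCoord φ p) :=
  (mdifferentiable_of_mem_maximalAtlas hφ).mfderiv_injective hp

/-- Every tangent vector is the combination of the coordinate vectors given by its components. -/
theorem eq_sum_coordVec (hφ : φ ∈ IsManifold.maximalAtlas (𝓡 (d + 1)) ∞ M)
    {y : EuclideanSpace ℝ (Fin (d + 1))} (hy : y ∈ φ.target)
    (v : TangentSpace (𝓡 (d + 1)) (φ.symm y)) :
    v = ∑ a, tangentCoord φ (φ.symm y) v a • coordVec φ y a := by
  apply tangentCoord_injective hφ (φ.map_target hy)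
  rw [map_sum]
  simp only [map_smul, tangentCoord_coordVec hφ hy]
  ext i
  simp [Pi.single_apply]

variable [IsManifold (𝓡 (d + 1)) ∞ M]

theorem contMDiffOn_coordVec (hφ : φ ∈ IsManifold.maximalAtlas (𝓡 (d + 1)) ∞ M)
    (i : Fin (d + 1)) :
    ContMDiffOn (𝓡 (d + 1)) (𝓡 (d + 1)).tangent ∞
      (fun y => (⟨φ.symm y, coordVec φ y i⟩ : TangentBundle (𝓡 (d + 1)) M)) φ.target := by
  have h1 := (contMDiffOn_symm_of_mem_maximalAtlas hφ).contMDiffOn_tangentMapWithin (m := ∞)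
    (by simp) φ.open_target.uniqueMDiffOn
  have h2 : ContMDiffOn (𝓡 (d + 1)) (𝓡 (d + 1)).tangent ∞
      (fun y : EuclideanSpace ℝ (Fin (d + 1)) =>
        (⟨y, EuclideanSpace.single i (1 : ℝ)⟩ : TangentBundle (𝓡 (d + 1)) _)) φ.target := by
    refine contMDiffOn_vectorSpace_iff_contDiffOn.2 ?_
    exact contDiffOn_const
  refine (h1.comp h2 fun y hy => hy).congr fun y hy => ?_
  simp only [Function.comp, tangentMapWithin, coordVec]
  rw [mfderivWithin_of_isOpen φ.open_target hy]

theorem contDiffOn_vecComp (hφ : φ ∈ IsManifold.maximalAtlas (𝓡 (d + 1)) ∞ M)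
    {u : (p : M) → TangentSpace (𝓡 (d + 1)) p}
    (hu : ContMDiff (𝓡 (d + 1)) (𝓡 (d + 1)).tangent ∞
      (fun p => (⟨p, u p⟩ : TangentBundle (𝓡 (d + 1)) M))) (a : Fin (d + 1)) :
    ContDiffOn ℝ ∞ (fun y => vecComp φ u y a) φ.target := by
  have h1 := (contMDiffOn_of_mem_maximalAtlas hφ).contMDiffOn_tangentMapWithin (m := ∞)
    (by simp) φ.open_source.uniqueMDiffOn
  have h2 := h1.comp (hu.comp_contMDiffOn (contMDiffOn_symm_of_mem_maximalAtlas hφ))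
    fun y hy => φ.map_target hy
  have h3 := (contMDiff_snd_tangentBundle_modelSpace (n := ∞) (EuclideanSpace ℝ (Fin (d + 1)))
    (𝓡 (d + 1))).comp_contMDiffOn h2
  have h4 := contMDiffOn_iff_contDiffOn.1 h3
  have h5 := (EuclideanSpace.proj (𝕜 := ℝ) a).contDiff.comp_contDiffOn (n := ∞) h4
  refine h5.congr fun y hy => ?_
  simp only [Function.comp, tangentMapWithin, vecComp]
  rw [mfderivWithin_of_isOpen φ.open_source (φ.map_target hy)]
  rfl

variable (g : LorentzMetric d M)

theorem contDiffOn_comp (hφ : φ ∈ IsManifold.maximalAtlas (𝓡 (d + 1)) ∞ M) (a b : Fin (d + 1)) :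
    ContDiffOn ℝ ∞ (fun y => g.comp φ y a b) φ.target := by
  intro y hy
  have hφs := contMDiffOn_symm_of_mem_maximalAtlas hφ
  have : ContMDiffWithinAt (𝓡 (d + 1)) ((𝓡 (d + 1)).prod 𝓘(ℝ)) ∞
      (fun y => TotalSpace.mk' ℝ (E := Bundle.Trivial M ℝ) (φ.symm y)
        (g.val (φ.symm y) (coordVec φ y a) (coordVec φ y b))) φ.target y := by
    apply ContMDiffWithinAt.clm_bundle_apply₂ (F₁ := EuclideanSpace ℝ (Fin (d + 1)))
      (F₂ := EuclideanSpace ℝ (Fin (d + 1)))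
    · exact ContMDiffAt.comp_contMDiffWithinAt y g.contMDiff.contMDiffAt (hφs y hy)
    · exact contMDiffOn_coordVec hφ a y hy
    · exact contMDiffOn_coordVec hφ b y hy
  simp only [contMDiffWithinAt_totalSpace] at this
  exact this.2.contDiffWithinAt

theorem comp_symm (φ : OpenPartialHomeomorph M (EuclideanSpace ℝ (Fin (d + 1))))
    (y : EuclideanSpace ℝ (Fin (d + 1))) (a b : Fin (d + 1)) :
    g.comp φ y a b = g.comp φ y b a :=
  g.symm _ _ _

theorem val_coordVec (hφ : φ ∈ IsManifold.maximalAtlas (𝓡 (d + 1)) ∞ M)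
    {y : EuclideanSpace ℝ (Fin (d + 1))} (hy : y ∈ φ.target)
    (v : TangentSpace (𝓡 (d + 1)) (φ.symm y)) (a : Fin (d + 1)) :
    g.val (φ.symm y) (coordVec φ y a) v
      = ∑ b, g.comp φ y a b * tangentCoord φ (φ.symm y) v b := by
  conv_lhs => rw [eq_sum_coordVec hφ hy v]
  rw [map_sum]
  simp only [map_smul, smul_eq_mul]
  exact Finset.sum_congr rfl fun b _ => mul_comm _ _

theorem val_eq_sum (hφ : φ ∈ IsManifold.maximalAtlas (𝓡 (d + 1)) ∞ M)
    {p : M} (hp : p ∈ φ.source) (v w : TangentSpace (𝓡 (d + 1)) p) :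
    g.val p v w = ∑ a, (∑ b, g.comp φ (φ p) a b * tangentCoord φ p v b) *
      tangentCoord φ p w a := by
  obtain ⟨y, hy, rfl⟩ : ∃ y ∈ φ.target, φ.symm y = p := ⟨φ p, φ.map_source hp, φ.left_inv hp⟩
  rw [φ.right_inv hy, g.symm]
  conv_lhs => rw [eq_sum_coordVec hφ hy w]
  simp only [map_sum, map_smul, sum_apply, smul_apply,
    smul_eq_mul, g.val_coordVec hφ hy]
  exact Finset.sum_congr rfl fun b _ => mul_comm _ _

/-- The metric is non-degenerate. -/
theorem eq_zero_of_val_eq_zero {p : M} {v : TangentSpace (𝓡 (d + 1)) p}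
    (hv : ∀ w, g.val p v w = 0) : v = 0 := by
  obtain ⟨e, he⟩ := g.signature p
  rw [← e.sum_repr v]
  refine Finset.sum_eq_zero fun i _ => ?_
  have h := hv (e i)
  rw [← e.sum_repr v, map_sum, sum_apply] at h
  simp only [map_smul, smul_apply, he, smul_eq_mul] at h
  rw [Finset.sum_eq_single i (fun j _ hj => by rw [if_neg hj, mul_zero]) (by simp),
    if_pos rfl] at h
  have : e.repr v i = 0 := by
    rcases mul_eq_zero.1 h with h | h
    · exact h
    · split_ifs at h <;> norm_num at h
  rw [this, zero_smul]

/-- A nonzero vector orthogonal to a unit timelike vector is spacelike. -/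
theorem val_pos_of_orthogonal {p : M} {t v : TangentSpace (𝓡 (d + 1)) p}
    (ht : g.val p t t = -1) (hv : g.val p t v = 0) (hv0 : v ≠ 0) : 0 < g.val p v v := by
  obtain ⟨e, he⟩ := g.signature p
  have hexp : ∀ v w, g.val p v w = -(e.repr v 0 * e.repr w 0)
      + ∑ i : Fin d, e.repr v i.succ * e.repr w i.succ := by
    intro v w
    have h1 : ∀ i, g.val p (e i) w = e.repr w i * (if i = 0 then -1 else 1) := by
      intro i
      conv_lhs => rw [← e.sum_repr w]
      rw [map_sum]
      simp only [map_smul, he, smul_eq_mul]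
      simp
    conv_lhs => rw [← e.sum_repr v]
    simp only [map_sum, map_smul, sum_apply, smul_apply,
      smul_eq_mul, h1]
    rw [Fin.sum_univ_succ]
    simp
  rw [hexp] at ht hv ⊢
  -- by the Cauchy-Schwarz inequality the spatial part of `v` dominates its time component
  have hcs := Finset.sum_mul_sq_le_sq_mul_sq Finset.univ
    (fun i : Fin d => e.repr t i.succ) (fun i : Fin d => e.repr v i.succ)
  set T := e.repr t 0
  set W := e.repr v 0
  set A := ∑ i : Fin d, e.repr t i.succ ^ 2 with hA
  set B := ∑ i : Fin d, e.repr v i.succ ^ 2 with hB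
  have hA' : ∑ i : Fin d, e.repr t i.succ * e.repr t i.succ = A := by simp only [hA, sq]
  have hB' : ∑ i : Fin d, e.repr v i.succ * e.repr v i.succ = B := by simp only [hB, sq]
  rw [hA'] at ht
  rw [hB']
  have hTW : ∑ i : Fin d, e.repr t i.succ * e.repr v i.succ = T * W := by linarith
  rw [hTW] at hcs
  have hA0 : 0 ≤ A := Finset.sum_nonneg fun i _ => sq_nonneg _
  have hB0 : 0 ≤ B := Finset.sum_nonneg fun i _ => sq_nonneg _
  have hBpos : 0 < B := by
    refine hB0.lt_of_ne fun hB00 => hv0 ?_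
    have hW : W = 0 := by
      rw [← hB00] at hcs
      have h1 : T * W = 0 := by nlinarith [sq_nonneg (T * W)]
      have hT : T ≠ 0 := fun h => by rw [h] at ht; linarith
      exact (mul_eq_zero.1 h1).resolve_left hT
    rw [← e.sum_repr v]
    refine Finset.sum_eq_zero fun i _ => ?_
    refine Fin.cases ?_ (fun j => ?_) i
    · rw [show e.repr v 0 = 0 from hW, zero_smul]
    · have := (Finset.sum_eq_zero_iff_of_nonneg (fun i _ => sq_nonneg _)).1 hB00.symm j
        (Finset.mem_univ _)
      rw [pow_eq_zero_iff two_ne_zero] at this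
      rw [this, zero_smul]
  have hT2 : T ^ 2 = 1 + A := by nlinarith
  have hW2 : (1 + A) * W ^ 2 ≤ A * B := by rw [← hT2, ← mul_pow]; exact hcs
  nlinarith [sq_nonneg W]

theorem isUnit_det_comp (hφ : φ ∈ IsManifold.maximalAtlas (𝓡 (d + 1)) ∞ M)
    {y : EuclideanSpace ℝ (Fin (d + 1))} (hy : y ∈ φ.target) : IsUnit (g.comp φ y).det := by
  rw [isUnit_iff_ne_zero]
  intro h0
  obtain ⟨c, hc0, hc⟩ := Matrix.exists_mulVec_eq_zero_iff.2 h0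
  let v : TangentSpace (𝓡 (d + 1)) (φ.symm y) := ∑ b, c b • coordVec φ y b
  have hvc : tangentCoord φ (φ.symm y) v = WithLp.toLp 2 c := by
    simp only [v, map_sum, map_smul, tangentCoord_coordVec hφ hy]
    ext i
    simp [Pi.single_apply]
  have hv : v = 0 := by
    apply g.eq_zero_of_val_eq_zero
    intro w
    rw [g.symm, eq_sum_coordVec hφ hy w]
    simp only [map_sum, map_smul, sum_apply, smul_apply]
    refine Finset.sum_eq_zero fun a _ => ?_
    rw [g.val_coordVec hφ hy, hvc]
    have := congrFun hc a
    simp only [Matrix.mulVec, dotProduct, Pi.zero_apply] at this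
    simp [this]
  rw [hv, map_zero] at hvc
  apply hc0
  ext i
  exact (congrArg (fun z : EuclideanSpace ℝ (Fin (d + 1)) => z i) hvc).symm

theorem isObserverOn (hφ : φ ∈ IsManifold.maximalAtlas (𝓡 (d + 1)) ∞ M)
    {u : (p : M) → TangentSpace (𝓡 (d + 1)) p} (hu : g.IsUnitTimelike u) :
    Coord.IsObserverOn (g.comp φ) (vecComp φ u) φ.target where
  isOpen := φ.open_target
  smooth := g.contDiffOn_comp hφ
  symm := g.comp_symm φ
  isUnit_det := fun _ hy => g.isUnit_det_comp hφ hy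
  smooth_vec := contDiffOn_vecComp hφ hu.1
  unit := fun y hy => by
    have h := g.val_eq_sum hφ (φ.map_target hy) (u (φ.symm y)) (u (φ.symm y))
    rw [hu.2, φ.right_inv hy] at h
    exact h.symm

/-- Passing to new coordinates: if `Ψ` is smooth with invertible derivative at `z₀`, then the
inverse of `φ.symm ∘ Ψ` is, after restriction, a chart whose image is a ball around `z₀`, and
components of vectors transform by the derivative of `Ψ`. -/
theorem exists_chart_comp (hφ : φ ∈ IsManifold.maximalAtlas (𝓡 (d + 1)) ∞ M)
    {Ψ : EuclideanSpace ℝ (Fin (d + 1)) → EuclideanSpace ℝ (Fin (d + 1))}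
    {s : Set (EuclideanSpace ℝ (Fin (d + 1)))} {z₀ : EuclideanSpace ℝ (Fin (d + 1))}
    (hs : s ∈ 𝓝 z₀) (hsφ : Set.MapsTo Ψ s φ.target) (hΨ : ContDiffOn ℝ ∞ Ψ s)
    (A : EuclideanSpace ℝ (Fin (d + 1)) ≃L[ℝ] EuclideanSpace ℝ (Fin (d + 1)))
    (hA : HasFDerivAt Ψ (A : _ →L[ℝ] _) z₀) :
    ∃ φ' ∈ IsManifold.maximalAtlas (𝓡 (d + 1)) ∞ M, φ.symm (Ψ z₀) ∈ φ'.source ∧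
      Convex ℝ φ'.target ∧ z₀ ∈ φ'.target ∧ φ'.target ⊆ s ∧
      ∀ z ∈ φ'.target, φ'.symm z = φ.symm (Ψ z) ∧ Function.Injective (fderiv ℝ Ψ z) ∧
        ∀ v, tangentCoord φ (φ'.symm z) v = fderiv ℝ Ψ z (tangentCoord φ' (φ'.symm z) v) := by
  obtain ⟨s', hs's, hs'o, hz₀⟩ := mem_nhds_iff.1 hs
  obtain ⟨e, hze, hes, heΨ, hesm, hesymm, heder⟩ := ContDiffOn.exists_openPartialHomeomorph hs'o
    hz₀ (hΨ.mono hs's) A hA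
  obtain ⟨r, hr, hball⟩ := Metric.isOpen_iff.1 e.open_source z₀ hze
  let e' := e.restrOpen (Metric.ball z₀ r) Metric.isOpen_ball
  have he's : e'.source = Metric.ball z₀ r := by
    show e.source ∩ Metric.ball z₀ r = _
    exact Set.inter_eq_right.2 hball
  have he'Ψ : (e' : _ → _) = Ψ := heΨ
  have he't : e'.target ⊆ e.target := fun z hz => by
    have := e.map_source (e'.map_target hz).1
    rwa [show e (e'.symm z) = z from e'.right_inv hz] at this
  let φ' := φ.trans e'.symm
  have htgt : φ'.target = Metric.ball z₀ r := by
    rw [OpenPartialHomeomorph.trans_target]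
    show e'.source ∩ e' ⁻¹' φ.target = _
    rw [he's, Set.inter_eq_left, he'Ψ]
    exact fun z hz => hsφ (hs's (hes (hball hz)))
  have hsymm : ∀ z, φ'.symm z = φ.symm (Ψ z) := fun z => by rw [← he'Ψ]; rfl
  have hz0 : z₀ ∈ φ'.target := by rw [htgt]; exact Metric.mem_ball_self hr
  have hts : φ'.target ⊆ s := by
    rw [htgt]
    exact fun z hz => hs's (hes (hball hz))
  have hφ' : φ' ∈ IsManifold.maximalAtlas (𝓡 (d + 1)) ∞ M := by
    apply φ'.mem_maximalAtlas_of_contMDiffOn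
    · have h1 : ContMDiffOn (𝓡 (d + 1)) (𝓡 (d + 1)) ∞ e.symm e'.target :=
        (hesymm.mono he't).contMDiffOn
      refine h1.comp ((contMDiffOn_of_mem_maximalAtlas hφ).mono ?_) ?_
      · exact fun x hx => hx.1
      · exact fun x hx => hx.2
    · have h1 : ContMDiffOn (𝓡 (d + 1)) (𝓡 (d + 1)) ∞ Ψ φ'.target :=
        (hΨ.mono hts).contMDiffOn
      exact ((contMDiffOn_symm_of_mem_maximalAtlas hφ).comp h1 fun z hz => hsφ (hts hz)).congr
        fun z _ => hsymm z
  refine ⟨φ', hφ', ?_, ?_, hz0, hts, ?_⟩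
  · rw [← hsymm]
    exact φ'.map_target hz0
  · rw [htgt]
    exact convex_ball _ _
  · intro z hz
    have hzb : z ∈ Metric.ball z₀ r := by rwa [htgt] at hz
    obtain ⟨B, hB⟩ := heder z (hball hzb)
    refine ⟨hsymm z, ?_, ?_⟩
    · rw [hB.fderiv]
      exact B.injective
    · set p := φ'.symm z with hp
      have hps : p ∈ φ'.source := φ'.map_target hz
      have hφp : φ' p = z := φ'.right_inv hz
      have heq : (φ : M → _) =ᶠ[𝓝 p] Ψ ∘ φ' := by
        filter_upwards [φ'.open_source.mem_nhds hps] with q hq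
        show φ q = Ψ (e'.symm (φ q))
        rw [← he'Ψ]
        exact (e'.right_inv hq.2).symm
      have h1 : MDifferentiableAt (𝓡 (d + 1)) (𝓡 (d + 1)) Ψ (φ' p) := by
        rw [hφp]
        exact hB.differentiableAt.mdifferentiableAt
      have h2 : MDifferentiableAt (𝓡 (d + 1)) (𝓡 (d + 1)) φ' p :=
        (mdifferentiable_of_mem_maximalAtlas hφ').mdifferentiableAt hps
      have h3 : mfderiv (𝓡 (d + 1)) (𝓡 (d + 1)) φ p
          = (mfderiv (𝓡 (d + 1)) (𝓡 (d + 1)) Ψ (φ' p)).comp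
            (mfderiv (𝓡 (d + 1)) (𝓡 (d + 1)) φ' p) := by
        rw [← mfderiv_comp p h1 h2]
        exact heq.mfderiv_eq
      have h4 : mfderiv (𝓡 (d + 1)) (𝓡 (d + 1)) Ψ (φ' p) = fderiv ℝ Ψ z := by
        rw [mfderiv_eq_fderiv, hφp]
      intro v
      have h5 := DFunLike.congr_fun h3 v
      rw [h4] at h5
      exact h5

end LorentzMetric

/-! ### Straightening a vector field -/

/-- Flow-box theorem, in the form of a parametrization `Ψ` with `∂_0 Ψ = X ∘ Ψ`. -/
theorem exists_flowBox {m : ℕ}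
    {X : EuclideanSpace ℝ (Fin (m + 1)) → EuclideanSpace ℝ (Fin (m + 1))}
    {Ω : Set (EuclideanSpace ℝ (Fin (m + 1)))} (hΩ : IsOpen Ω) (hX : ContDiffOn ℝ ∞ X Ω)
    {y₀ : EuclideanSpace ℝ (Fin (m + 1))} (hy₀ : y₀ ∈ Ω) (hX₀ : X y₀ ≠ 0) :
    ∃ (Ψ : EuclideanSpace ℝ (Fin (m + 1)) → EuclideanSpace ℝ (Fin (m + 1)))
      (s : Set (EuclideanSpace ℝ (Fin (m + 1))))
      (A : EuclideanSpace ℝ (Fin (m + 1)) ≃L[ℝ] EuclideanSpace ℝ (Fin (m + 1))),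
      s ∈ 𝓝 0 ∧ Set.MapsTo Ψ s Ω ∧ ContDiffOn ℝ ∞ Ψ s ∧ Ψ 0 = y₀ ∧
      HasFDerivAt Ψ (A : _ →L[ℝ] _) 0 ∧
      ∀ z ∈ s, fderiv ℝ Ψ z (EuclideanSpace.single 0 1) = X (Ψ z) := by
  set e₀ : EuclideanSpace ℝ (Fin (m + 1)) := EuclideanSpace.single 0 1 with he₀
  obtain ⟨X₁, hX₁, hXX₁⟩ := hX.exists_contDiff_eventuallyEq hΩ hy₀
  obtain ⟨N, hN, hNo, hy₀N⟩ := eventually_nhds_iff.1 (hXX₁.and (hΩ.mem_nhds hy₀))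
  obtain ⟨Φ, δ, hδ, hΦ, hflow⟩ := exists_contDiffOn_flow hX₁ y₀
  have he₀ne : e₀ ≠ 0 := by simp [he₀]
  obtain ⟨A, hA⟩ := SeparatingDual.exists_continuousLinearEquiv_apply_eq (R := ℝ) he₀ne hX₀
  -- `z ↦ (z_0, y₀ + A (z - z_0 e_0))`
  let τ : EuclideanSpace ℝ (Fin (m + 1)) →L[ℝ] ℝ := EuclideanSpace.proj 0
  let B : EuclideanSpace ℝ (Fin (m + 1)) →L[ℝ] EuclideanSpace ℝ (Fin (m + 1)) :=
    (A : _ →L[ℝ] _).comp (ContinuousLinearMap.id ℝ _ - τ.smulRight e₀)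
  have hτe : τ e₀ = 1 := by simp [τ, he₀]
  have hBe : B e₀ = 0 := by simp [B, hτe]
  let ι : EuclideanSpace ℝ (Fin (m + 1)) → ℝ × EuclideanSpace ℝ (Fin (m + 1)) :=
    fun z => (τ z, y₀ + B z)
  have hι : ContDiff ℝ ∞ ι := τ.contDiff.prodMk (contDiff_const.add B.contDiff)
  have hι' : ∀ z, HasFDerivAt ι (τ.prod B) z := fun z =>
    τ.hasFDerivAt.prodMk (B.hasFDerivAt.const_add y₀)
  have hι0 : ι 0 = (0, y₀) := by simp [ι]
  have hb0 : ((0 : ℝ), y₀) ∈ Metric.ball ((0 : ℝ), y₀) δ := Metric.mem_ball_self hδ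
  let s₁ := ι ⁻¹' Metric.ball (0, y₀) δ
  have hs₁ : IsOpen s₁ := Metric.isOpen_ball.preimage hι.continuous
  have h0s₁ : (0 : EuclideanSpace ℝ (Fin (m + 1))) ∈ s₁ := by
    show ι 0 ∈ Metric.ball (0, y₀) δ
    rwa [hι0]
  have hΨ₁ : ContDiffOn ℝ ∞ (Φ ∘ ι) s₁ := hΦ.comp hι.contDiffOn fun z hz => hz
  have hΨ0 : (Φ ∘ ι) 0 = y₀ := by
    show Φ (ι 0) = y₀
    rw [hι0]
    exact (hflow _ hb0).1
  have hs : s₁ ∩ (Φ ∘ ι) ⁻¹' N ∈ 𝓝 (0 : EuclideanSpace ℝ (Fin (m + 1))) := by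
    refine Filter.inter_mem (hs₁.mem_nhds h0s₁) ?_
    refine (hΨ₁.continuousOn.continuousAt (hs₁.mem_nhds h0s₁)).preimage_mem_nhds ?_
    rw [hΨ0]
    exact hNo.mem_nhds hy₀N
  have hder : ∀ z ∈ s₁, HasFDerivAt (Φ ∘ ι) ((fderiv ℝ Φ (ι z)).comp (τ.prod B)) z := by
    intro z hz
    have h1 : DifferentiableAt ℝ Φ (ι z) :=
      (hΦ.contDiffAt (Metric.isOpen_ball.mem_nhds hz)).differentiableAt (by simp)
    exact h1.hasFDerivAt.comp z (hι' z)
  have htime : ∀ q ∈ Metric.ball ((0 : ℝ), y₀) δ, fderiv ℝ Φ q (1, 0) = X₁ (Φ q) := by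
    intro q hq
    have h1 : DifferentiableAt ℝ Φ q :=
      (hΦ.contDiffAt (Metric.isOpen_ball.mem_nhds hq)).differentiableAt (by simp)
    have h2 : HasDerivAt (fun t => Φ (t, q.2)) (fderiv ℝ Φ q (1, 0)) q.1 :=
      HasFDerivAt.comp_hasDerivAt (f := fun t => (t, q.2)) q.1 h1.hasFDerivAt
        ((hasDerivAt_id q.1).prodMk (hasDerivAt_const q.1 q.2))
    exact h2.unique (hflow q hq).2
  have hspace : ∀ v, fderiv ℝ Φ (0, y₀) (0, v) = v := by
    intro v
    have h1 : DifferentiableAt ℝ Φ (0, y₀) :=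
      (hΦ.contDiffAt (Metric.isOpen_ball.mem_nhds hb0)).differentiableAt (by simp)
    have h2 : HasFDerivAt (fun x => Φ (0, x))
        ((fderiv ℝ Φ (0, y₀)).comp (ContinuousLinearMap.inr ℝ ℝ _)) y₀ :=
      HasFDerivAt.comp y₀ h1.hasFDerivAt (hasFDerivAt_prodMk_right 0 y₀)
    have h3 : (fun x => Φ (0, x)) =ᶠ[𝓝 y₀] id := by
      filter_upwards [Metric.ball_mem_nhds y₀ hδ] with x hx
      refine (hflow (0, x) ?_).1
      rw [Metric.mem_ball, Prod.dist_eq]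
      simpa [hδ] using hx
    have h4 := h2.unique ((hasFDerivAt_id y₀).congr_of_eventuallyEq h3)
    exact DFunLike.congr_fun h4 v
  refine ⟨Φ ∘ ι, s₁ ∩ (Φ ∘ ι) ⁻¹' N, A, hs, fun z hz => (hN _ hz.2).2,
    hΨ₁.mono Set.inter_subset_left, hΨ0, ?_, ?_⟩
  · refine (hder 0 h0s₁).congr_fderiv ?_
    ext1 v
    rw [hι0]
    have h1 : (τ.prod B) v = τ v • ((1 : ℝ), (0 : EuclideanSpace ℝ (Fin (m + 1)))) + (0, B v) := by
      simp
    rw [ContinuousLinearMap.comp_apply, h1, map_add, map_smul, htime _ hb0, hspace,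
      (hflow _ hb0).1, (hN _ hy₀N).1, ← hA]
    simp [B]
  · intro z hz
    rw [(hder z hz.1).fderiv, ContinuousLinearMap.comp_apply]
    have h1 : (τ.prod B) e₀ = (1, 0) := by simp [hτe, hBe]
    rw [h1, htime _ hz.1]
    exact (hN _ hz.2).1

/-! ### Integrable one-forms -/

/-- A one-form `η` with `dη = A ∧ η` is transported along an `η`-isotropic flow: if the curves
`r ↦ F (r, x)` are everywhere tangent to `ker η`, then a variation of the initial value that
starts in `ker η` stays in `ker η`. The value of `η` on the variation solves a linear
differential equation, because `∂_r` and the variation commute. -/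
theorem apply_fderiv_eq_zero_of_isotropic {E V : Type*} [NormedAddCommGroup E] [NormedSpace ℝ E]
    [NormedAddCommGroup V] [NormedSpace ℝ V] {Ω : Set E} (hΩ : IsOpen Ω) {η A : E → E →L[ℝ] ℝ}
    (hη : ContDiffOn ℝ ∞ η Ω) (hA : ContinuousOn A Ω)
    (hdη : ∀ y ∈ Ω, ∀ v w, fderiv ℝ η y v w - fderiv ℝ η y w v = A y v * η y w - A y w * η y v)
    {F : ℝ × V → E} {T : Set (ℝ × V)} (hT : IsOpen T) (hF : ContDiffOn ℝ ∞ F T)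
    (hFT : Set.MapsTo F T Ω) (hiso : ∀ q ∈ T, η (F q) (fderiv ℝ F q (1, 0)) = 0)
    {x e : V} {t : ℝ} (ht : 0 ≤ t) (hxT : ∀ r ∈ Set.Icc 0 t, (r, x) ∈ T)
    (h0 : η (F (0, x)) (fderiv ℝ F (0, x) (0, e)) = 0) :
    η (F (t, x)) (fderiv ℝ F (t, x) (0, e)) = 0 := by
  have hF1 : ∀ q ∈ T, HasFDerivAt F (fderiv ℝ F q) q := fun q hq =>
    ((hF.contDiffAt (hT.mem_nhds hq)).differentiableAt (by simp)).hasFDerivAt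
  have hF2 : ∀ q ∈ T, HasFDerivAt (fderiv ℝ F) (fderiv ℝ (fderiv ℝ F) q) q := fun q hq =>
    (((hF.contDiffAt (hT.mem_nhds hq)).fderiv_right (m := 1) (by norm_cast)).differentiableAt
      (by simp)).hasFDerivAt
  have hη1 : ∀ q ∈ T, HasFDerivAt (fun q => η (F q)) ((fderiv ℝ η (F q)).comp (fderiv ℝ F q)) q :=
    fun q hq => (((hη.contDiffAt (hΩ.mem_nhds (hFT hq))).differentiableAt
      (by simp)).hasFDerivAt).comp q (hF1 q hq)
  have hpair : ∀ q ∈ T, ∀ v w, HasFDerivAt (fun q => η (F q) (fderiv ℝ F q v))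
      ((η (F q)).comp ((fderiv ℝ (fderiv ℝ F) q).flip v)
        + ((fderiv ℝ η (F q)).comp (fderiv ℝ F q)).flip (fderiv ℝ F q v)) q ∧
      ((η (F q)).comp ((fderiv ℝ (fderiv ℝ F) q).flip v)
        + ((fderiv ℝ η (F q)).comp (fderiv ℝ F q)).flip (fderiv ℝ F q v)) w
      = η (F q) (fderiv ℝ (fderiv ℝ F) q w v)
        + fderiv ℝ η (F q) (fderiv ℝ F q w) (fderiv ℝ F q v) := by
    intro q hq v w
    refine ⟨?_, by simp⟩
    have h1 : HasFDerivAt (fun q => fderiv ℝ F q v) ((fderiv ℝ (fderiv ℝ F) q).flip v) q := by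
      have := (hF2 q hq).clm_apply (hasFDerivAt_const v q)
      simpa using this
    exact (hη1 q hq).clm_apply h1
  have hZ : ∀ q ∈ T, HasDerivAt (fun r => η (F (r, q.2)) (fderiv ℝ F (r, q.2) (0, e)))
      (A (F q) (fderiv ℝ F q (1, 0)) * η (F q) (fderiv ℝ F q (0, e))) q.1 := by
    intro q hq
    have h1 := (hpair q hq (0, e) (1, 0)).1
    have h2 : HasDerivAt (fun r => η (F (r, q.2)) (fderiv ℝ F (r, q.2) (0, e))) _ q.1 :=
      HasFDerivAt.comp_hasDerivAt (f := fun r => (r, q.2)) q.1 h1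
        ((hasDerivAt_id q.1).prodMk (hasDerivAt_const q.1 q.2))
    refine h2.congr_deriv ?_
    rw [(hpair q hq (0, e) (1, 0)).2]
    have h3 : HasFDerivAt (fun q => η (F q) (fderiv ℝ F q (1, 0))) (0 : ℝ × V →L[ℝ] ℝ) q :=
      (hasFDerivAt_const (0 : ℝ) q).congr_of_eventuallyEq (by
        filter_upwards [hT.mem_nhds hq] with q' hq'
        exact hiso q' hq')
    have h4 := DFunLike.congr_fun ((hpair q hq (1, 0) (0, e)).1.unique h3) (0, e)
    rw [(hpair q hq (1, 0) (0, e)).2] at h4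
    have h5 := hdη (F q) (hFT hq) (fderiv ℝ F q (1, 0)) (fderiv ℝ F q (0, e))
    rw [hiso q hq, mul_zero, sub_zero] at h5
    have h6 : fderiv ℝ (fderiv ℝ F) q (1, 0) (0, e) = fderiv ℝ (fderiv ℝ F) q (0, e) (1, 0) := by
      refine ((hF.contDiffAt (hT.mem_nhds hq)).isSymmSndFDerivAt ?_) _ _
      simp only [minSmoothness_of_isRCLikeNormedField]
      exact WithTop.coe_le_coe.2 le_top
    rw [h6]
    have h7 : (0 : ℝ × V →L[ℝ] ℝ) (0, e) = 0 := rfl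
    rw [h7] at h4
    linarith
  have hcurve : ContinuousOn (fun r : ℝ => (r, x)) (Set.Icc 0 t) := by fun_prop
  have hFc : ContinuousOn (fun r => F (r, x)) (Set.Icc 0 t) := hF.continuousOn.comp hcurve hxT
  have hF'c : ContinuousOn (fun r => fderiv ℝ F (r, x) (1, 0)) (Set.Icc 0 t) := by
    have h1 : ContinuousOn (fderiv ℝ F) T := hF.continuousOn_fderiv_of_isOpen hT (by simp)
    exact (h1.comp hcurve hxT).clm_apply continuousOn_const
  have hac : ContinuousOn (fun r => A (F (r, x)) (fderiv ℝ F (r, x) (1, 0))) (Set.Icc 0 t) :=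
    (hA.comp hFc fun r hr => hFT (hxT r hr)).clm_apply hF'c
  obtain ⟨K, hK⟩ := isCompact_Icc.exists_bound_of_continuousOn hac
  refine eq_zero_of_abs_deriv_le_mul_abs_self_of_eq_zero_right
    (f := fun r => η (F (r, x)) (fderiv ℝ F (r, x) (0, e))) (K := K)
    (f' := fun r => A (F (r, x)) (fderiv ℝ F (r, x) (1, 0)) * η (F (r, x))
      (fderiv ℝ F (r, x) (0, e))) (a := 0) (b := t)
    (fun r hr => (hZ (r, x) (hxT r hr)).continuousAt.continuousWithinAt)
    (fun r hr => (hZ (r, x) (hxT r (Set.Ico_subset_Icc_self hr))).hasDerivWithinAt) h0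
    (fun r hr => ?_) t (Set.right_mem_Icc.2 ht)
  rw [norm_mul]
  gcongr
  exact hK r (Set.Ico_subset_Icc_self hr)

/-- Frobenius' theorem for an integrable one-form `η` with `η(∂_0) = -1`: there is a
parametrization `Ψ` that maps the `0`-lines to `0`-lines and whose other partial derivatives
are annihilated by `η`. The leaf through `y₀ + z_0 e_0` is swept out by the integral curves of
`y ↦ v + η_y(v) e_0` for constant vectors `v`. -/
theorem exists_leafCoordinates {m : ℕ}
    {Ω : Set (EuclideanSpace ℝ (Fin (m + 1)))} (hΩ : IsOpen Ω)
    {η A : EuclideanSpace ℝ (Fin (m + 1)) → EuclideanSpace ℝ (Fin (m + 1)) →L[ℝ] ℝ}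
    (hη : ContDiffOn ℝ ∞ η Ω) (hA : ContinuousOn A Ω)
    (hdη : ∀ y ∈ Ω, ∀ v w, fderiv ℝ η y v w - fderiv ℝ η y w v = A y v * η y w - A y w * η y v)
    (hη0 : ∀ y ∈ Ω, η y (EuclideanSpace.single 0 1) = -1)
    {y₀ : EuclideanSpace ℝ (Fin (m + 1))} (hy₀ : y₀ ∈ Ω) :
    ∃ (Ψ : EuclideanSpace ℝ (Fin (m + 1)) → EuclideanSpace ℝ (Fin (m + 1)))
      (s : Set (EuclideanSpace ℝ (Fin (m + 1))))
      (B : EuclideanSpace ℝ (Fin (m + 1)) ≃L[ℝ] EuclideanSpace ℝ (Fin (m + 1))),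
      s ∈ 𝓝 0 ∧ Set.MapsTo Ψ s Ω ∧ ContDiffOn ℝ ∞ Ψ s ∧ Ψ 0 = y₀ ∧
      HasFDerivAt Ψ (B : _ →L[ℝ] _) 0 ∧
      ∀ z ∈ s, (∃ c : ℝ, 0 < c ∧
          fderiv ℝ Ψ z (EuclideanSpace.single 0 1) = c • EuclideanSpace.single 0 1) ∧
        ∀ α : Fin m, η (Ψ z) (fderiv ℝ Ψ z (EuclideanSpace.single α.succ 1)) = 0 := by
  set e₀ : EuclideanSpace ℝ (Fin (m + 1)) := EuclideanSpace.single 0 1 with he₀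
  -- for `q = (y, v)` the second component `v` is constant along the flow
  let X : EuclideanSpace ℝ (Fin (m + 1)) × EuclideanSpace ℝ (Fin (m + 1)) →
      EuclideanSpace ℝ (Fin (m + 1)) × EuclideanSpace ℝ (Fin (m + 1)) :=
    fun q => (q.2 + η q.1 q.2 • e₀, 0)
  have hX : ContDiffOn ℝ ∞ X (Ω ×ˢ Set.univ) := by
    have h1 : ContDiffOn ℝ ∞
        (fun q : EuclideanSpace ℝ (Fin (m + 1)) × EuclideanSpace ℝ (Fin (m + 1)) => η q.1 q.2)
        (Ω ×ˢ Set.univ) :=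
      (hη.comp contDiffOn_fst fun q hq => hq.1).clm_apply contDiffOn_snd
    exact (contDiffOn_snd.add (h1.smul contDiffOn_const)).prodMk contDiffOn_const
  have hΩ2 : IsOpen (Ω ×ˢ (Set.univ : Set (EuclideanSpace ℝ (Fin (m + 1))))) := hΩ.prod isOpen_univ
  have hq₀ : (y₀, (0 : EuclideanSpace ℝ (Fin (m + 1)))) ∈ Ω ×ˢ (Set.univ : Set _) := ⟨hy₀, trivial⟩
  obtain ⟨X₁, hX₁, hXX₁⟩ := hX.exists_contDiff_eventuallyEq hΩ2 hq₀
  obtain ⟨N, hN, hNo, hq₀N⟩ := eventually_nhds_iff.1 (hXX₁.and (hΩ2.mem_nhds hq₀))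
  obtain ⟨Φ, δ', hδ', hΦ', hflow'⟩ := exists_contDiffOn_flow hX₁ (y₀, 0)
  have hb' := Metric.mem_ball_self (x := ((0 : ℝ), y₀, (0 : EuclideanSpace ℝ (Fin (m + 1))))) hδ'
  obtain ⟨δ, hδ, hδN⟩ := Metric.mem_nhds_iff.1 (Filter.inter_mem (Metric.ball_mem_nhds _ hδ')
    ((hΦ'.continuousOn.continuousAt (Metric.isOpen_ball.mem_nhds hb')).preimage_mem_nhds
      (by rw [(hflow' _ hb').1]; exact hNo.mem_nhds hq₀N)))
  set T : Set (ℝ × EuclideanSpace ℝ (Fin (m + 1)) × EuclideanSpace ℝ (Fin (m + 1))) :=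
    Metric.ball (0, y₀, 0) δ with hTdef
  have hT : IsOpen T := Metric.isOpen_ball
  have hTmem : ∀ t y v, (t, y, v) ∈ T ↔ |t| < δ ∧ dist y y₀ < δ ∧ ‖v‖ < δ := by
    intro t y v
    rw [hTdef, Metric.mem_ball, Prod.dist_eq, max_lt_iff, Prod.dist_eq, max_lt_iff]
    simp
  have hΦ : ContDiffOn ℝ ∞ Φ T := hΦ'.mono fun q hq => (hδN hq).1
  have hinit : ∀ q ∈ T, Φ (0, q.2) = q.2 := fun q hq => (hflow' q (hδN hq).1).1
  have hder : ∀ q ∈ T, HasDerivAt (fun t => Φ (t, q.2)) (X (Φ q)) q.1 := by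
    intro q hq
    have h1 := (hflow' q (hδN hq).1).2
    rwa [(hN _ (hδN hq).2).1] at h1
  have hΦΩ : ∀ q ∈ T, (Φ q).1 ∈ Ω := fun q hq => (hN _ (hδN hq).2).2.1
  -- a real function with constant derivative on the time interval is affine
  have haff : ∀ (f : ℝ → ℝ) (c : ℝ), (∀ t, |t| < δ → HasDerivAt f c t) →
      ∀ t, |t| < δ → f t = f 0 + c * t := by
    intro f c hf t ht
    have hconv : Convex ℝ {t : ℝ | |t| < δ} := by
      have : {t : ℝ | |t| < δ} = Metric.ball 0 δ := by ext; simp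
      rw [this]
      exact convex_ball _ _
    have h1 := hconv.is_const_of_fderivWithin_eq_zero (𝕜 := ℝ) (f := fun t => f t - c * t)
      (fun r hr => ((hf r hr).fun_sub
        ((hasDerivAt_id' r).const_mul c)).differentiableAt.differentiableWithinAt)
      (fun r hr => ?_) ht (y := 0) (by simpa using hδ)
    · simp only [mul_zero, sub_zero] at h1
      linarith
    · have h2 : HasDerivAt (fun t => f t - c * t) 0 r := by
        simpa using (hf r hr).fun_sub ((hasDerivAt_id' r).const_mul c)
      have h3 : IsOpen {t : ℝ | |t| < δ} := isOpen_lt continuous_abs continuous_const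
      rw [fderivWithin_of_isOpen h3 hr, h2.hasFDerivAt.fderiv]
      simp
  have hTt : ∀ q ∈ T, ∀ t : ℝ, |t| < δ → (t, q.2) ∈ T := fun q hq t ht =>
    (hTmem _ _ _).2 ⟨ht, ((hTmem q.1 q.2.1 q.2.2).1 hq).2⟩
  have hsnd : ∀ q ∈ T, (Φ q).2 = q.2.2 := by
    intro q hq
    ext i
    have h1 := haff (fun t => (Φ (t, q.2)).2 i) 0 (fun t ht => by
      have h3 := ((EuclideanSpace.proj (𝕜 := ℝ) i).comp
        (ContinuousLinearMap.snd ℝ _ _)).hasFDerivAt.comp_hasDerivAt t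
          (hder _ (hTt q hq t ht))
      exact h3.congr_deriv (by simp [X])) q.1 ((hTmem _ _ _).1 hq).1
    rw [hinit q hq] at h1
    simpa using h1
  let F : ℝ × EuclideanSpace ℝ (Fin (m + 1)) × EuclideanSpace ℝ (Fin (m + 1)) →
      EuclideanSpace ℝ (Fin (m + 1)) := fun q => (Φ q).1
  have hF : ContDiffOn ℝ ∞ F T := contDiff_fst.comp_contDiffOn hΦ
  have hFd : ∀ q ∈ T, HasFDerivAt F (fderiv ℝ F q) q := fun q hq =>
    ((hF.contDiffAt (hT.mem_nhds hq)).differentiableAt (by simp)).hasFDerivAt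
  have hFtime : ∀ q ∈ T, HasDerivAt (fun t => F (t, q.2)) (q.2.2 + η (F q) q.2.2 • e₀) q.1 := by
    intro q hq
    have h1 := (ContinuousLinearMap.fst ℝ _ _).hasFDerivAt.comp_hasDerivAt q.1 (hder q hq)
    simp only [X, hsnd q hq] at h1
    exact h1
  have hFtime' : ∀ q ∈ T, fderiv ℝ F q (1, 0) = q.2.2 + η (F q) q.2.2 • e₀ := by
    intro q hq
    have h2 : HasDerivAt (fun t => F (t, q.2)) (fderiv ℝ F q (1, 0)) q.1 :=
      HasFDerivAt.comp_hasDerivAt (f := fun t => (t, q.2)) q.1 (hFd q hq)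
        ((hasDerivAt_id q.1).prodMk (hasDerivAt_const q.1 q.2))
    exact h2.unique (hFtime q hq)
  have hiso : ∀ q ∈ T, η (F q) (fderiv ℝ F q (1, 0)) = 0 := by
    intro q hq
    rw [hFtime' q hq, map_add, map_smul, hη0 _ (hΦΩ q hq)]
    simp
  have hFsucc : ∀ q ∈ T, ∀ α : Fin m, F q α.succ = q.2.1 α.succ + q.2.2 α.succ * q.1 := by
    intro q hq α
    have h1 := haff (fun t => F (t, q.2) α.succ) (q.2.2 α.succ) (fun t ht => by
      have h3 := (EuclideanSpace.proj (𝕜 := ℝ) α.succ).hasFDerivAt.comp_hasDerivAt t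
        (hFtime _ (hTt q hq t ht))
      exact h3.congr_deriv (by simp [he₀])) q.1 ((hTmem _ _ _).1 hq).1
    simp only [F] at h1
    rw [hinit q hq] at h1
    exact h1
  -- `Ψ z` follows the flow up to the time `r = δ / 2`, from `y₀ + z_0 e_0` and with velocity
  -- `(z - z_0 e_0) / r`
  set r := δ / 2 with hr
  have hrpos : 0 < r := half_pos hδ
  have hrδ : |r| < δ := by rw [abs_of_pos hrpos]; exact half_lt_self hδ
  let τ : EuclideanSpace ℝ (Fin (m + 1)) →L[ℝ] ℝ := EuclideanSpace.proj 0
  let P : EuclideanSpace ℝ (Fin (m + 1)) →L[ℝ] EuclideanSpace ℝ (Fin (m + 1)) :=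
    r⁻¹ • (ContinuousLinearMap.id ℝ _ - τ.smulRight e₀)
  let D : EuclideanSpace ℝ (Fin (m + 1)) →L[ℝ]
      ℝ × EuclideanSpace ℝ (Fin (m + 1)) × EuclideanSpace ℝ (Fin (m + 1)) :=
    (0 : _ →L[ℝ] ℝ).prod ((τ.smulRight e₀).prod P)
  let ι : EuclideanSpace ℝ (Fin (m + 1)) →
      ℝ × EuclideanSpace ℝ (Fin (m + 1)) × EuclideanSpace ℝ (Fin (m + 1)) :=
    fun z => (r, y₀ + z 0 • e₀, P z)
  have hι : ContDiff ℝ ∞ ι := contDiff_const.prodMk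
    ((contDiff_const.add (τ.smulRight e₀).contDiff).prodMk P.contDiff)
  have hι' : ∀ z, HasFDerivAt ι D z := fun z =>
    (hasFDerivAt_const r z).prodMk
      (((τ.smulRight e₀).hasFDerivAt.const_add y₀).prodMk P.hasFDerivAt)
  let s₁ := ι ⁻¹' T
  have hs₁ : IsOpen s₁ := hT.preimage hι.continuous
  have h0s₁ : (0 : EuclideanSpace ℝ (Fin (m + 1))) ∈ s₁ := by
    refine (hTmem _ _ _).2 ⟨hrδ, ?_, ?_⟩ <;> simp [hδ]
  let Ψ : EuclideanSpace ℝ (Fin (m + 1)) → EuclideanSpace ℝ (Fin (m + 1)) := fun z => F (ι z)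
  have hΨ : ContDiffOn ℝ ∞ Ψ s₁ := hF.comp hι.contDiffOn fun z hz => hz
  have hΨd : ∀ z ∈ s₁, HasFDerivAt Ψ (fderiv ℝ Ψ z) z := fun z hz =>
    ((hΨ.contDiffAt (hs₁.mem_nhds hz)).differentiableAt (by simp)).hasFDerivAt
  have hΨ' : ∀ z ∈ s₁, fderiv ℝ Ψ z = (fderiv ℝ F (ι z)).comp D := fun z hz =>
    ((hFd _ hz).comp z (hι' z)).fderiv
  have hPe₀ : P e₀ = 0 := by simp [P, τ, he₀]
  have hPsucc : ∀ (z : EuclideanSpace ℝ (Fin (m + 1))) (α : Fin m),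
      P z α.succ = r⁻¹ * z α.succ := by
    intro z α
    simp [P, τ, he₀]
  have hΨsucc : ∀ z ∈ s₁, ∀ α : Fin m, Ψ z α.succ = y₀ α.succ + z α.succ := by
    intro z hz α
    have h1 := hFsucc _ hz α
    simp only [ι, hPsucc] at h1
    simp only [Ψ, ι, h1]
    rw [mul_comm r⁻¹, mul_assoc, inv_mul_cancel₀ hrpos.ne']
    simp [he₀]
  have hΨ'succ : ∀ z ∈ s₁, ∀ (v : EuclideanSpace ℝ (Fin (m + 1))) (α : Fin m),
      fderiv ℝ Ψ z v α.succ = v α.succ := by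
    intro z hz v α
    have h1 : HasFDerivAt (fun z => Ψ z α.succ)
        ((EuclideanSpace.proj (𝕜 := ℝ) α.succ).comp (fderiv ℝ Ψ z)) z :=
      (EuclideanSpace.proj (𝕜 := ℝ) α.succ).hasFDerivAt.comp z (hΨd z hz)
    have h2 : HasFDerivAt (fun z => Ψ z α.succ)
        (EuclideanSpace.proj α.succ : EuclideanSpace ℝ (Fin (m + 1)) →L[ℝ] ℝ) z := by
      refine ((EuclideanSpace.proj α.succ :
        EuclideanSpace ℝ (Fin (m + 1)) →L[ℝ] ℝ).hasFDerivAt.const_add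
          (y₀ α.succ)).congr_of_eventuallyEq ?_
      filter_upwards [hs₁.mem_nhds hz] with z' hz'
      exact hΨsucc z' hz' α
    exact DFunLike.congr_fun (h1.unique h2) v
  -- on the line `z = z_0 e_0` the velocity `v` vanishes, and the flow is stationary
  have hΨline : ∀ t : ℝ, |t| < δ → Ψ (t • e₀) = y₀ + t • e₀ := by
    intro t ht
    have hι1 : ι (t • e₀) = (r, y₀ + t • e₀, 0) := by
      simp only [ι, map_smul, hPe₀, smul_zero]
      simp [he₀]
    have hmem : (r, y₀ + t • e₀, (0 : EuclideanSpace ℝ (Fin (m + 1)))) ∈ T := by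
      refine (hTmem _ _ _).2 ⟨hrδ, ?_, by simpa using hδ⟩
      simpa [he₀, norm_smul] using ht
    show F (ι (t • e₀)) = _
    rw [hι1]
    ext i
    have h1 := haff (fun t' => F (t', y₀ + t • e₀, 0) i) 0 (fun t' ht' => by
      have h3 := (EuclideanSpace.proj (𝕜 := ℝ) i).hasFDerivAt.comp_hasDerivAt t'
        (hFtime _ (hTt _ hmem t' ht'))
      exact h3.congr_deriv (by simp)) r hrδ
    have h2 : F (0, y₀ + t • e₀, 0) = y₀ + t • e₀ := congrArg Prod.fst (hinit _ hmem)
    rw [h2] at h1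
    simpa using h1
  have hΨ0 : Ψ 0 = y₀ := by simpa using hΨline 0 (by simpa using hδ)
  have hΨ'0 : fderiv ℝ Ψ 0 e₀ = e₀ := by
    have h1 : HasDerivAt (fun t : ℝ => Ψ (t • e₀)) (fderiv ℝ Ψ 0 e₀) 0 := by
      have h2 : HasFDerivAt Ψ (fderiv ℝ Ψ 0) ((0 : ℝ) • e₀) := by
        rw [zero_smul]
        exact hΨd 0 h0s₁
      have h3 := h2.comp_hasDerivAt (0 : ℝ) ((hasDerivAt_id (0 : ℝ)).smul_const e₀)
      exact h3.congr_deriv (by simp)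
    have h2 : HasDerivAt (fun t : ℝ => Ψ (t • e₀)) e₀ 0 := by
      have h3 : HasDerivAt (fun t : ℝ => y₀ + t • e₀) e₀ 0 := by
        simpa using ((hasDerivAt_id (0 : ℝ)).smul_const e₀).const_add y₀
      refine h3.congr_of_eventuallyEq ?_
      filter_upwards [Metric.ball_mem_nhds (0 : ℝ) hδ] with t ht
      exact hΨline t (by simpa using ht)
    exact h1.unique h2
  have hinj : Function.Injective (fderiv ℝ Ψ 0) := by
    rw [injective_iff_map_eq_zero]
    intro v hv
    have h1 : ∀ α : Fin m, v α.succ = 0 := fun α => by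
      rw [← hΨ'succ 0 h0s₁, hv]
      rfl
    have h2 : v = v 0 • e₀ := by
      ext i
      refine Fin.cases ?_ (fun α => ?_) i
      · simp [he₀]
      · simp [he₀, h1]
    rw [h2, map_smul, hΨ'0] at hv
    rw [h2, hv]
  let B : EuclideanSpace ℝ (Fin (m + 1)) ≃L[ℝ] EuclideanSpace ℝ (Fin (m + 1)) :=
    (LinearEquiv.ofInjectiveEndo
      (fderiv ℝ Ψ 0 : EuclideanSpace ℝ (Fin (m + 1)) →ₗ[ℝ] EuclideanSpace ℝ (Fin (m + 1)))
      hinj).toContinuousLinearEquiv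
  have hB : (B : _ →L[ℝ] _) = fderiv ℝ Ψ 0 := by
    ext1 v
    rfl
  have hcpos : {z | 0 < fderiv ℝ Ψ z e₀ 0} ∈ 𝓝 (0 : EuclideanSpace ℝ (Fin (m + 1))) := by
    have h1 : ContinuousAt (fderiv ℝ Ψ) 0 :=
      (hΨ.continuousOn_fderiv_of_isOpen hs₁ (by simp)).continuousAt (hs₁.mem_nhds h0s₁)
    have h2 : ContinuousAt (fun z => fderiv ℝ Ψ z e₀ 0) 0 :=
      (EuclideanSpace.proj (𝕜 := ℝ) (0 : Fin (m + 1))).continuous.continuousAt.comp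
        (h1.clm_apply continuousAt_const)
    refine h2.eventually (lt_mem_nhds ?_)
    show 0 < fderiv ℝ Ψ 0 e₀ 0
    rw [hΨ'0]
    simp [he₀]
  refine ⟨Ψ, s₁ ∩ {z | 0 < fderiv ℝ Ψ z e₀ 0}, B,
    Filter.inter_mem (hs₁.mem_nhds h0s₁) hcpos, fun z hz => hΦΩ _ hz.1,
    hΨ.mono Set.inter_subset_left, hΨ0, ?_, fun z hz => ⟨⟨_, hz.2, ?_⟩, fun α => ?_⟩⟩
  · rw [hB]
    exact hΨd 0 h0s₁
  · ext i
    refine Fin.cases ?_ (fun α => ?_) i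
    · simp [he₀]
    · rw [hΨ'succ z hz.1]
      simp [he₀]
  · -- at time `0` the variation of the initial point is zero, so `η` annihilates it there
    have hDe : D (EuclideanSpace.single α.succ 1)
        = (0, (0, r⁻¹ • EuclideanSpace.single α.succ 1)) := by
      simp [D, P, τ]
    rw [hΨ' z hz.1, ContinuousLinearMap.comp_apply, hDe]
    have hz1 : ∀ t ∈ Set.Icc 0 r, (t, (ι z).2) ∈ T := fun t ht =>
      hTt _ hz.1 t (by
        rw [abs_of_nonneg ht.1]
        exact ht.2.trans_lt (half_lt_self hδ))
    refine apply_fderiv_eq_zero_of_isotropic hΩ hη hA hdη hT hF hΦΩ hiso hrpos.le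
      (x := (ι z).2) (e := (0, r⁻¹ • EuclideanSpace.single α.succ 1)) hz1 ?_
    have h0T := hz1 0 (Set.left_mem_Icc.2 hrpos.le)
    have h1 : HasFDerivAt (fun x => F (0, x))
        ((fderiv ℝ F (0, (ι z).2)).comp (ContinuousLinearMap.inr ℝ ℝ _)) (ι z).2 :=
      HasFDerivAt.comp (ι z).2 (hFd _ h0T) (hasFDerivAt_prodMk_right (0 : ℝ) (ι z).2)
    have h2 : HasFDerivAt (fun x => F (0, x)) (ContinuousLinearMap.fst ℝ _ _) (ι z).2 := by
      refine hasFDerivAt_fst.congr_of_eventuallyEq ?_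
      have h3 : {x | ((0 : ℝ), x) ∈ T} ∈ 𝓝 (ι z).2 :=
        (hT.preimage (Continuous.prodMk_right (0 : ℝ))).mem_nhds h0T
      filter_upwards [h3] with x hx
      exact congrArg Prod.fst (hinit _ hx)
    have h3 := DFunLike.congr_fun (h1.unique h2) (0, r⁻¹ • EuclideanSpace.single α.succ 1)
    have h4 : fderiv ℝ F (0, (ι z).2) (0, (0, r⁻¹ • EuclideanSpace.single α.succ 1)) = 0 := h3
    rw [h4, map_zero]

/-! ### Adapted coordinates -/

namespace Coord

variable {n : ℕ} {Ω : Set (EuclideanSpace ℝ (Fin n))}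

theorem fderiv_apply_eq_sum_pd (f : EuclideanSpace ℝ (Fin n) → ℝ)
    (y v : EuclideanSpace ℝ (Fin n)) : fderiv ℝ f y v = ∑ b, v b * pd b f y := by
  have hv : v = ∑ b, v b • EuclideanSpace.single b (1 : ℝ) := by
    ext i
    simp [Pi.single_apply]
  conv_lhs => rw [hv]
  rw [map_sum]
  simp [pd]

/-- The one-form `∑ a, f a dy^a`. -/
noncomputable def oneForm (f : Fin n → EuclideanSpace ℝ (Fin n) → ℝ)
    (y : EuclideanSpace ℝ (Fin n)) : EuclideanSpace ℝ (Fin n) →L[ℝ] ℝ :=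
  ∑ a, f a y • EuclideanSpace.proj (𝕜 := ℝ) a

theorem oneForm_apply (f : Fin n → EuclideanSpace ℝ (Fin n) → ℝ)
    (y v : EuclideanSpace ℝ (Fin n)) : oneForm f y v = ∑ a, f a y * v a := by
  simp [oneForm]

theorem contDiffOn_oneForm {f : Fin n → EuclideanSpace ℝ (Fin n) → ℝ}
    (hf : ∀ a, ContDiffOn ℝ ∞ (f a) Ω) : ContDiffOn ℝ ∞ (oneForm f) Ω :=
  ContDiffOn.sum fun a _ => (hf a).smul contDiffOn_const

theorem fderiv_oneForm_apply (hΩ : IsOpen Ω) {f : Fin n → EuclideanSpace ℝ (Fin n) → ℝ}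
    (hf : ∀ a, ContDiffOn ℝ ∞ (f a) Ω) {y : EuclideanSpace ℝ (Fin n)} (hy : y ∈ Ω)
    (v w : EuclideanSpace ℝ (Fin n)) :
    fderiv ℝ (oneForm f) y v w = ∑ a, ∑ b, pd b (f a) y * (v b * w a) := by
  have h1 : HasFDerivAt (oneForm f)
      (∑ a, (fderiv ℝ (f a) y).smulRight (EuclideanSpace.proj (𝕜 := ℝ) a)) y :=
    HasFDerivAt.fun_sum fun a _ =>
      (differentiableAt_of_contDiffOn hΩ (hf a) hy).hasFDerivAt.smul_const
        (EuclideanSpace.proj a : EuclideanSpace ℝ (Fin n) →L[ℝ] ℝ)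
  rw [h1.fderiv]
  simp only [ContinuousLinearMap.smulRight_apply, smul_apply, smul_eq_mul, sum_apply,
    fderiv_apply_eq_sum_pd]
  refine Finset.sum_congr rfl fun a _ => ?_
  rw [Finset.sum_mul]
  exact Finset.sum_congr rfl fun b _ => by
    rw [show EuclideanSpace.proj a w = w a from rfl]
    ring

variable {G : EuclideanSpace ℝ (Fin n) → Matrix (Fin n) (Fin n) ℝ}
  {U : EuclideanSpace ℝ (Fin n) → Fin n → ℝ}

/-- For a twist-free observer the exterior derivative of the one-form `u_a dy^a` is the wedge
product of the acceleration with it, so that its kernel is integrable. -/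
theorem IsObserverOn.fderiv_oneForm_lower_sub (h : IsObserverOn G U Ω)
    {y : EuclideanSpace ℝ (Fin n)} (hy : y ∈ Ω) (hω : ∀ a b, twist G U a b y = 0)
    (v w : EuclideanSpace ℝ (Fin n)) :
    fderiv ℝ (oneForm (lower G U)) y v w - fderiv ℝ (oneForm (lower G U)) y w v
      = oneForm (acceleration G U) y v * oneForm (lower G U) y w
        - oneForm (acceleration G U) y w * oneForm (lower G U) y v := by
  have hpd : ∀ a b, pd b (lower G U a) y - pd a (lower G U b) y
      = lower G U a y * acceleration G U b y - lower G U b y * acceleration G U a y := by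
    intro a b
    have h1 := hω a b
    simp only [twist, h.spatialDeriv_eq hy, covDeriv, h.christoffel_symm _ a b] at h1
    linarith
  rw [fderiv_oneForm_apply h.isOpen h.contDiffOn_lower hy,
    fderiv_oneForm_apply h.isOpen h.contDiffOn_lower hy, Finset.sum_comm (γ := Fin n)
      (f := fun a b => pd b (lower G U a) y * (w b * v a))]
  simp only [oneForm_apply, Finset.sum_mul_sum]
  rw [Finset.sum_comm (f := fun a b => acceleration G U a y * v a * (lower G U b y * w b)),
    ← Finset.sum_sub_distrib, ← Finset.sum_sub_distrib]
  refine Finset.sum_congr rfl fun a _ => ?_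
  rw [← Finset.sum_sub_distrib, ← Finset.sum_sub_distrib]
  refine Finset.sum_congr rfl fun b _ => ?_
  linear_combination (v b * w a) * hpd a b

end Coord

namespace LorentzMetric

variable {d : ℕ} {M : Type*} [TopologicalSpace M]
  [ChartedSpace (EuclideanSpace ℝ (Fin (d + 1))) M] [IsManifold (𝓡 (d + 1)) ∞ M]
  (g : LorentzMetric d M) {u : (p : M) → TangentSpace (𝓡 (d + 1)) p}

/-- Every point has a neighbourhood with coordinates in which `u` is `∂_0`. -/
theorem exists_chart_tangentCoord_eq (hu : g.IsUnitTimelike u) (p : M) :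
    ∃ φ ∈ IsManifold.maximalAtlas (𝓡 (d + 1)) ∞ M, p ∈ φ.source ∧
      ∀ q ∈ φ.source, tangentCoord φ q (u q) = EuclideanSpace.single 0 1 := by
  set φ := chartAt (EuclideanSpace ℝ (Fin (d + 1))) p with hφdef
  have hφ : φ ∈ IsManifold.maximalAtlas (𝓡 (d + 1)) ∞ M := IsManifold.chart_mem_maximalAtlas p
  have hp : p ∈ φ.source := mem_chart_source _ p
  have hX : ContDiffOn ℝ ∞ (fun y => WithLp.toLp 2 (vecComp φ u y)) φ.target :=
    contDiffOn_euclidean.2 fun a => contDiffOn_vecComp hφ hu.1 a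
  have hX' : ∀ q ∈ φ.source, WithLp.toLp 2 (vecComp φ u (φ q)) = tangentCoord φ q (u q) := by
    intro q hq
    ext a
    exact (tangentCoord_apply_vec u hq a).symm
  have hX₀ : WithLp.toLp 2 (vecComp φ u (φ p)) ≠ 0 := by
    rw [hX' p hp]
    intro h0
    have h1 : u p = 0 := tangentCoord_injective hφ hp (h0.trans (map_zero _).symm)
    have h2 := hu.2 p
    rw [h1, map_zero] at h2
    norm_num at h2
  obtain ⟨Ψ, s, A, hs, hsφ, hΨ, hΨ0, hA, hΨX⟩ :=
    exists_flowBox φ.open_target hX (φ.map_source hp) hX₀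
  obtain ⟨φ', hφ', hpφ', -, -, hts, hφ''⟩ := exists_chart_comp hφ hs hsφ hΨ A hA
  refine ⟨φ', hφ', ?_, fun q hq => ?_⟩
  · rwa [hΨ0, φ.left_inv hp] at hpφ'
  · obtain ⟨z, hz, rfl⟩ : ∃ z ∈ φ'.target, φ'.symm z = q :=
      ⟨φ' q, φ'.map_source hq, φ'.left_inv hq⟩
    obtain ⟨h1, hinj, h2⟩ := hφ'' z hz
    apply hinj
    rw [← h2, hΨX z (hts hz), ← φ.right_inv (hsφ (hts hz)), ← h1,
      hX' _ (h1 ▸ φ.map_target (hsφ (hts hz)))]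

/-- Every point has a neighbourhood with adapted coordinates: leaf coordinates of the integrable
one-form `u_a dy^a`, over a chart in which `u` is `∂_0`. The chart has a convex image, which
contains the required segments. -/
theorem exists_isAdaptedChart (hu : g.IsUnitTimelike u) (htwist : g.IsTwistFree u) (p : M) :
    ∃ φ ∈ IsManifold.maximalAtlas (𝓡 (d + 1)) ∞ M, p ∈ φ.source ∧ g.IsAdaptedChart u φ := by
  obtain ⟨φ, hφ, hp, hφu⟩ := g.exists_chart_tangentCoord_eq hu p
  have hobs := g.isObserverOn hφ hu
  have hη0 : ∀ y ∈ φ.target, Coord.oneForm (Coord.lower (g.comp φ) (vecComp φ u)) y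
      (EuclideanSpace.single 0 1) = -1 := by
    intro y hy
    rw [Coord.oneForm_apply, ← hobs.unit y hy]
    refine Finset.sum_congr rfl fun a _ => ?_
    rw [vecComp_eq, hφu _ (φ.map_target hy)]
  obtain ⟨Ψ, s, B, hs, hsφ, hΨ, hΨ0, hB, hleaf⟩ := exists_leafCoordinates φ.open_target
    (Coord.contDiffOn_oneForm hobs.contDiffOn_lower)
    (Coord.contDiffOn_oneForm hobs.contDiffOn_acceleration).continuousOn
    (fun y hy v w => hobs.fderiv_oneForm_lower_sub hy (htwist φ hφ y hy) v w) hη0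
    (φ.map_source hp)
  obtain ⟨φ', hφ', hpφ', hconv, -, hts, hφ''⟩ := exists_chart_comp hφ hs hsφ hΨ B hB
  refine ⟨φ', hφ', ?_, fun z hz => ?_, fun z hz α => ?_,
    fun y hy z hz _ => hconv.segment_subset hy hz⟩
  · rwa [hΨ0, φ.left_inv hp] at hpφ'
  · obtain ⟨h1, -, h2⟩ := hφ'' z hz
    obtain ⟨c, hc, h3⟩ := (hleaf z (hts hz)).1
    have hq : φ'.symm z ∈ φ.source := h1 ▸ φ.map_target (hsφ (hts hz))
    refine ⟨c, hc, tangentCoord_injective hφ hq ?_⟩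
    rw [map_smul, h2 (coordVec φ' z 0), tangentCoord_coordVec hφ' hz, h3, hφu _ hq, smul_smul,
      inv_mul_cancel₀ hc.ne', one_smul]
  · obtain ⟨h1, -, h2⟩ := hφ'' z hz
    have hq : φ'.symm z ∈ φ.source := h1 ▸ φ.map_target (hsφ (hts hz))
    have h3 : φ (φ'.symm z) = Ψ z := by rw [h1, φ.right_inv (hsφ (hts hz))]
    have h4 := (hleaf z (hts hz)).2 α
    rw [g.val_eq_sum hφ hq, h2 (coordVec φ' z α.succ), tangentCoord_coordVec hφ' hz, ← h4,
      Coord.oneForm_apply]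
    refine Finset.sum_congr rfl fun a _ => ?_
    congr 1
    rw [← h3, Coord.lower]
    exact Finset.sum_congr rfl fun b _ => by rw [tangentCoord_apply_vec u hq]

end LorentzMetric

/-! ### The line element in adapted coordinates -/

namespace Coord

variable {d : ℕ} {Ω : Set (EuclideanSpace ℝ (Fin (d + 1)))}
  {G : EuclideanSpace ℝ (Fin (d + 1)) → Matrix (Fin (d + 1)) (Fin (d + 1)) ℝ}
  {U : EuclideanSpace ℝ (Fin (d + 1)) → Fin (d + 1) → ℝ}

/-- In coordinates `(t, x)` with `u` along `∂_t` and orthogonal to the slices, vanishing shear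
means that the spatial metric is rescaled along the lines of constant `x`. -/
theorem IsObserverOn.exists_pd_zero_eq (h : IsObserverOn G U Ω)
    (hU0 : ∀ y ∈ Ω, U y 0 ≠ 0) (hU : ∀ y ∈ Ω, ∀ α : Fin d, U y α.succ = 0)
    (hG : ∀ y ∈ Ω, ∀ α : Fin d, G y 0 α.succ = 0)
    {y : EuclideanSpace ℝ (Fin (d + 1))} (hy : y ∈ Ω) (hσ : ∀ a b, shear G U a b y = 0) :
    ∃ c : ℝ, ∀ α β : Fin d,
      pd 0 (fun z => G z α.succ β.succ) y = c * G y α.succ β.succ := by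
  have hL : ∀ z ∈ Ω, ∀ α : Fin d, lower G U α.succ z = 0 := by
    intro z hz α
    rw [lower, Fin.sum_univ_succ, h.symm, hG z hz]
    simp [hU z hz]
  have hG' : ∀ z ∈ Ω, ∀ α : Fin d, G z α.succ 0 = 0 := fun z hz α => by rw [h.symm, hG z hz]
  have hpd0 : ∀ {f : EuclideanSpace ℝ (Fin (d + 1)) → ℝ} (k : Fin (d + 1)),
      (∀ z ∈ Ω, f z = 0) → pd k f y = 0 := by
    intro f k hf
    rw [pd_congr h.isOpen (g := fun _ => 0) hf hy, pd_const]
  -- `∇_β u_α = -Γ^c_{βα} u_c`, and `u_c = u^0 g_{0c}`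
  have hcov : ∀ α β : Fin d, covDeriv G U β.succ α.succ y
      = U y 0 / 2 * pd 0 (fun z => G z β.succ α.succ) y := by
    intro α β
    have h1 : ∀ c, lower G U c y = G y 0 c * U y 0 := by
      intro c
      rw [lower, Fin.sum_univ_succ, h.symm]
      simp [hU y hy]
    have h2 : ∑ c, christoffel G c β.succ α.succ y * lower G U c y
        = U y 0 * ∑ c, G y 0 c * christoffel G c β.succ α.succ y := by
      rw [Finset.mul_sum]
      exact Finset.sum_congr rfl fun c _ => by rw [h1]; ring
    rw [covDeriv, h2, h.sum_mul_christoffel hy, hpd0 _ fun z hz => hL z hz α,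
      hpd0 _ fun z hz => hG z hz α, hpd0 _ fun z hz => hG z hz β]
    ring
  refine ⟨2 / U y 0 * (expansion G U y / (((d + 1 : ℕ) : ℝ) - 1)), fun α β => ?_⟩
  have h1 := hσ α.succ β.succ
  rw [shear, h.spatialDeriv_eq hy, h.spatialDeriv_eq hy, proj, hL y hy, hL y hy, hcov, hcov,
    show (fun z => G z β.succ α.succ) = fun z => G z α.succ β.succ from
      funext fun z => h.symm z _ _] at h1
  have h2 := hU0 y hy
  have h3 : U y 0 / 2 * pd 0 (fun z => G z α.succ β.succ) y
      = expansion G U y / (((d + 1 : ℕ) : ℝ) - 1) * G y α.succ β.succ := by linarith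
  rw [mul_assoc, ← h3]
  field_simp

end Coord

namespace LorentzMetric

variable {d : ℕ}

/-- A function with vanishing `∂_0` is constant along segments of constant `x`. -/
theorem eq_of_pd_zero_eq_zero {s : Set (EuclideanSpace ℝ (Fin (d + 1)))}
    {f : EuclideanSpace ℝ (Fin (d + 1)) → ℝ} (hf : ∀ y ∈ s, DifferentiableAt ℝ f y)
    (hf0 : ∀ y ∈ s, Coord.pd 0 f y = 0) {y z : EuclideanSpace ℝ (Fin (d + 1))}
    (hyz : segment ℝ y z ⊆ s) (hx : spatial y = spatial z) : f y = f z := by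
  have hv : z - y = (z 0 - y 0) • EuclideanSpace.single 0 1 := by
    ext i
    refine Fin.cases ?_ (fun α => ?_) i
    · simp
    · have := congrArg (fun x : EuclideanSpace ℝ (Fin d) => x α) hx
      simp only [spatial] at this
      simp [this]
  have hmem : ∀ t ∈ Set.Icc (0 : ℝ) 1, y + t • (z - y) ∈ s := fun t ht =>
    hyz (segment_eq_image' ℝ y z ▸ ⟨t, ht, rfl⟩)
  have hder : ∀ t ∈ Set.Icc (0 : ℝ) 1, HasDerivAt (fun t : ℝ => f (y + t • (z - y))) 0 t := by
    intro t ht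
    have h1 : HasDerivAt (fun t : ℝ => y + t • (z - y)) (z - y) t := by
      have := ((hasDerivAt_id t).smul_const (z - y)).const_add y
      rwa [one_smul] at this
    refine ((hf _ (hmem t ht)).hasFDerivAt.comp_hasDerivAt t h1).congr_deriv ?_
    have h2 := hf0 _ (hmem t ht)
    rw [Coord.pd] at h2
    rw [hv, map_smul, ← hv, h2, smul_zero]
  have h1 := constant_of_has_deriv_right_zero (f := fun t : ℝ => f (y + t • (z - y)))
    (fun t ht => (hder t ht).continuousAt.continuousWithinAt)
    (fun t ht => (hder t (Set.Ico_subset_Icc_self ht)).hasDerivWithinAt) 1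
    (Set.right_mem_Icc.2 zero_le_one)
  simpa using h1.symm

/-- A function that depends on the spatial coordinates only descends to a smooth function. -/
theorem contDiffOn_of_comp_spatial {s : Set (EuclideanSpace ℝ (Fin (d + 1)))} (hs : IsOpen s)
    {q : EuclideanSpace ℝ (Fin (d + 1)) → ℝ} (hq : ContDiffOn ℝ ∞ q s)
    {f : EuclideanSpace ℝ (Fin d) → ℝ} (hf : ∀ y ∈ s, f (spatial y) = q y) :
    ContDiffOn ℝ ∞ f (spatial '' s) := by
  rintro _ ⟨y, hy, rfl⟩
  let σ : EuclideanSpace ℝ (Fin d) → EuclideanSpace ℝ (Fin (d + 1)) := fun x =>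
    WithLp.toLp 2 (Fin.cons (y 0) x)
  have hσ : ContDiff ℝ ∞ σ := by
    refine contDiff_euclidean.2 fun i => Fin.cases ?_ (fun α => ?_) i
    · exact contDiff_const
    · exact (EuclideanSpace.proj (𝕜 := ℝ) α).contDiff
  have hσx : ∀ x, spatial (σ x) = x := fun x => rfl
  have hσy : σ (spatial y) = y := by
    ext i
    exact Fin.cases rfl (fun α => rfl) i
  have h1 : ContDiffAt ℝ ∞ (fun x => q (σ x)) (spatial y) :=
    ContDiffAt.comp (spatial y) (by rw [hσy]; exact hq.contDiffAt (hs.mem_nhds hy)) hσ.contDiffAt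
  refine (h1.congr_of_eventuallyEq ?_).contDiffWithinAt
  have h2 : σ ⁻¹' s ∈ 𝓝 (spatial y) :=
    (hs.preimage hσ.continuous).mem_nhds (by rw [Set.mem_preimage, hσy]; exact hy)
  filter_upwards [h2] with x hx
  rw [← hf _ hx, hσx]

variable {M : Type*} [TopologicalSpace M]
  [ChartedSpace (EuclideanSpace ℝ (Fin (d + 1))) M] [IsManifold (𝓡 (d + 1)) ∞ M]
  (g : LorentzMetric d M) {u : (p : M) → TangentSpace (𝓡 (d + 1)) p}
  {φ : OpenPartialHomeomorph M (EuclideanSpace ℝ (Fin (d + 1)))}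

/-- The components of the metric induced on the slices of constant `t`. -/
noncomputable def spatialComp (φ : OpenPartialHomeomorph M (EuclideanSpace ℝ (Fin (d + 1))))
    (y : EuclideanSpace ℝ (Fin (d + 1))) : Matrix (Fin d) (Fin d) ℝ :=
  (g.comp φ y).submatrix Fin.succ Fin.succ

theorem posDef_spatialComp (hφ : φ ∈ IsManifold.maximalAtlas (𝓡 (d + 1)) ∞ M)
    (hu : g.IsUnitTimelike u) {y : EuclideanSpace ℝ (Fin (d + 1))} (hy : y ∈ φ.target)
    (horth : ∀ α : Fin d, g.val (φ.symm y) (u (φ.symm y)) (coordVec φ y α.succ) = 0) :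
    (g.spatialComp φ y).PosDef := by
  refine Matrix.PosDef.of_dotProduct_mulVec_pos ?_ fun c hc => ?_
  · ext α β
    exact g.comp_symm φ y _ _
  let v : TangentSpace (𝓡 (d + 1)) (φ.symm y) := ∑ α : Fin d, c α • coordVec φ y α.succ
  have hvc : ∀ β : Fin d, tangentCoord φ (φ.symm y) v β.succ = c β := by
    intro β
    simp only [v, map_sum, map_smul, tangentCoord_coordVec hφ hy]
    simp [Pi.single_apply]
  have hv0 : v ≠ 0 := by
    intro h0
    apply hc
    ext β
    rw [← hvc β, h0, map_zero]
    rfl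
  have huv : g.val (φ.symm y) (u (φ.symm y)) v = 0 := by
    simp only [v, map_sum, map_smul, horth, smul_zero, Finset.sum_const_zero]
  have h1 := g.val_pos_of_orthogonal (hu.2 _) huv hv0
  have h2 : g.val (φ.symm y) v v = star c ⬝ᵥ (g.spatialComp φ y).mulVec c := by
    simp only [dotProduct, Matrix.mulVec, Pi.star_apply, star_trivial]
    conv_lhs =>
      enter [1]
      rw [show g.val (φ.symm y) v = ∑ α : Fin d, c α • g.val (φ.symm y) (coordVec φ y α.succ) by
        simp only [v, map_sum, map_smul]]
    simp only [sum_apply, smul_apply, smul_eq_mul, v, map_sum, map_smul]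
    refine Finset.sum_congr rfl fun α _ => ?_
    congr 1
    exact Finset.sum_congr rfl fun β _ => by
      rw [mul_comm, g.symm]
      rfl
  rwa [h2] at h1

/-- In adapted coordinates the spatial metric divided by its trace does not depend on `t`, because
the shear vanishes; it is the conformal metric `ξ`, and `P` is the square root of the trace. -/
theorem hasAdaptedForm_of_isAdaptedChart (hd : 2 ≤ d)
    (hφ : φ ∈ IsManifold.maximalAtlas (𝓡 (d + 1)) ∞ M) (hu : g.IsUnitTimelike u)
    (hshear : g.IsShearFree u) (hadapt : g.IsAdaptedChart u φ) : g.HasAdaptedForm u φ := by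
  obtain ⟨hV, horth, hseg⟩ := hadapt
  have hobs := g.isObserverOn hφ hu
  have : Nonempty (Fin d) := ⟨⟨0, by omega⟩⟩
  have hcomp : ∀ y ∈ φ.target, ∀ V : ℝ, u (φ.symm y) = V⁻¹ • coordVec φ y 0 →
      ∀ a, vecComp φ u y a = V⁻¹ * (EuclideanSpace.single (0 : Fin (d + 1)) (1 : ℝ)) a := by
    intro y hy V hVy a
    rw [vecComp_eq, hVy, map_smul, tangentCoord_coordVec hφ hy]
    rfl
  have hU0 : ∀ y ∈ φ.target, 0 < vecComp φ u y 0 := by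
    intro y hy
    obtain ⟨V, hVpos, hVy⟩ := hV y hy
    rw [hcomp y hy V hVy]
    simpa using hVpos
  have hU : ∀ y ∈ φ.target, ∀ α : Fin d, vecComp φ u y α.succ = 0 := by
    intro y hy α
    obtain ⟨V, hVpos, hVy⟩ := hV y hy
    rw [hcomp y hy V hVy]
    simp
  have huV : ∀ y ∈ φ.target, u (φ.symm y) = vecComp φ u y 0 • coordVec φ y 0 := by
    intro y hy
    obtain ⟨V, hVpos, hVy⟩ := hV y hy
    rw [hcomp y hy V hVy, hVy]
    simp
  have hG : ∀ y ∈ φ.target, ∀ α : Fin d, g.comp φ y 0 α.succ = 0 := by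
    intro y hy α
    have h1 := horth y hy α
    rw [huV y hy, map_smul, smul_apply, smul_eq_mul] at h1
    exact (mul_eq_zero.1 h1).resolve_left (hU0 y hy).ne'
  have hG00 : ∀ y ∈ φ.target, g.comp φ y 0 0 * vecComp φ u y 0 ^ 2 = -1 := by
    intro y hy
    have h1 := hu.2 (φ.symm y)
    rw [huV y hy, map_smul, map_smul, smul_apply, smul_eq_mul, smul_eq_mul] at h1
    rw [← h1]
    simp only [comp, Matrix.of_apply]
    ring
  have hpos : ∀ y ∈ φ.target, (g.spatialComp φ y).PosDef := fun y hy =>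
    g.posDef_spatialComp hφ hu hy (horth y hy)
  -- the trace of the spatial metric in the given coordinates
  let τ : EuclideanSpace ℝ (Fin (d + 1)) → ℝ := fun y => ∑ α, g.spatialComp φ y α α
  have hτ : ∀ y ∈ φ.target, 0 < τ y := fun y hy =>
    Finset.sum_pos (fun α _ => (hpos y hy).diag_pos) Finset.univ_nonempty
  have hS : ∀ α β, ContDiffOn ℝ ∞ (fun y => g.spatialComp φ y α β) φ.target := fun α β =>
    g.contDiffOn_comp hφ _ _
  have hτs : ContDiffOn ℝ ∞ τ φ.target := ContDiffOn.sum fun α _ => hS α α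
  let q : Fin d → Fin d → EuclideanSpace ℝ (Fin (d + 1)) → ℝ := fun α β y =>
    g.spatialComp φ y α β * (τ y)⁻¹
  have hqs : ∀ α β, ContDiffOn ℝ ∞ (q α β) φ.target := fun α β =>
    (hS α β).mul (hτs.inv fun y hy => (hτ y hy).ne')
  have hq0 : ∀ α β, ∀ y ∈ φ.target, Coord.pd 0 (q α β) y = 0 := by
    intro α β y hy
    obtain ⟨c, hc⟩ := hobs.exists_pd_zero_eq (fun z hz => (hU0 z hz).ne') hU hG hy
      (hshear φ hφ y hy)
    have hdiff : ∀ {f}, ContDiffOn ℝ ∞ f φ.target → DifferentiableAt ℝ f y := fun hf =>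
      Coord.differentiableAt_of_contDiffOn φ.open_target hf hy
    have h1 : Coord.pd 0 (fun z => g.spatialComp φ z α β) y
        = Coord.pd 0 (fun z => q α β z * τ z) y := by
      refine Coord.pd_congr φ.open_target (fun z hz => ?_) hy
      simp only [q]
      rw [inv_mul_cancel_right₀ (hτ z hz).ne']
    have h2 : Coord.pd 0 τ y = c * τ y := by
      simp only [τ]
      rw [Coord.pd_sum fun α _ => hdiff (hS α α), Finset.mul_sum]
      exact Finset.sum_congr rfl fun α _ => hc α α
    have h3 : q α β y * τ y = g.spatialComp φ y α β := inv_mul_cancel_right₀ (hτ y hy).ne' _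
    have h4 : Coord.pd 0 (fun z => g.spatialComp φ z α β) y = c * g.spatialComp φ y α β := hc α β
    rw [h4, Coord.pd_mul (hdiff (hqs α β)) (hdiff hτs), h2, ← h3] at h1
    have h5 : Coord.pd 0 (q α β) y * τ y = 0 := by linarith
    exact (mul_eq_zero.1 h5).resolve_right (hτ y hy).ne'
  -- `ξ x` is read off at an arbitrary point of the domain over `x`
  let ρ : EuclideanSpace ℝ (Fin d) → EuclideanSpace ℝ (Fin (d + 1)) :=
    Function.invFunOn spatial φ.target
  have hρ : ∀ x ∈ spatial '' φ.target, ρ x ∈ φ.target ∧ spatial (ρ x) = x := fun x hx =>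
    ⟨Function.invFunOn_mem hx, Function.invFunOn_eq hx⟩
  have hqρ : ∀ α β, ∀ y ∈ φ.target, q α β (ρ (spatial y)) = q α β y := by
    intro α β y hy
    obtain ⟨h1, h2⟩ := hρ _ (Set.mem_image_of_mem _ hy)
    exact eq_of_pd_zero_eq_zero
      (fun z hz => Coord.differentiableAt_of_contDiffOn φ.open_target (hqs α β) hz) (hq0 α β)
      (hseg _ h1 _ hy h2) h2
  refine ⟨fun y => (vecComp φ u y 0)⁻¹, fun y => √(τ y),
    fun x => Matrix.of fun α β => q α β (ρ x),
    (contDiffOn_vecComp hφ hu.1 0).inv fun y hy => (hU0 y hy).ne',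
    hτs.sqrt fun y hy => (hτ y hy).ne',
    fun α β => contDiffOn_of_comp_spatial φ.open_target (hqs α β) (hqρ α β), fun x hx => ?_,
    fun y hy => ⟨inv_pos.2 (hU0 y hy), Real.sqrt_pos.2 (hτ y hy), ?_, ?_,
      fun α => ⟨hG y hy α, (g.comp_symm φ y _ _).trans (hG y hy α)⟩, fun α β => ?_⟩⟩
  · have h1 := (hpos _ (hρ x hx).1).smul (inv_pos.2 (hτ _ (hρ x hx).1))
    convert h1 using 1
    ext α β
    exact mul_comm _ _
  · rw [inv_inv]
    exact huV y hy
  · have h1 := (hU0 y hy).ne'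
    have h2 := hG00 y hy
    field_simp
    exact h2
  · show g.spatialComp φ y α β = √(τ y) ^ 2 * q α β (ρ (spatial y))
    rw [Real.sq_sqrt (hτ y hy).le, hqρ α β y hy, mul_comm, inv_mul_cancel_right₀ (hτ y hy).ne']

end LorentzMetric

theorem proposition5 {d : ℕ} (hd : 2 ≤ d) {M : Type*} [TopologicalSpace M]
    [ChartedSpace (EuclideanSpace ℝ (Fin (d + 1))) M] [IsManifold (𝓡 (d + 1)) ∞ M]
    (g : LorentzMetric d M) (u : (p : M) → TangentSpace (𝓡 (d + 1)) p)
    (hu : g.IsUnitTimelike u) (hshear : g.IsShearFree u) (htwist : g.IsTwistFree u) :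
    g.IsPurelyElectric u ∧
    (∀ p : M, ∃ φ ∈ IsManifold.maximalAtlas (𝓡 (d + 1)) ∞ M,
      p ∈ φ.source ∧ g.IsAdaptedChart u φ ∧ g.HasAdaptedForm u φ) ∧
    (∀ φ ∈ IsManifold.maximalAtlas (𝓡 (d + 1)) ∞ M,
      g.IsAdaptedChart u φ → g.HasAdaptedForm u φ) := by
  refine ⟨fun φ hφ y hy => ?_, fun p => ?_, fun φ hφ hadapt => ?_⟩
  · exact (g.isObserverOn hφ hu).weylMagnetic_eq_zero (by omega) hy (hshear φ hφ) (htwist φ hφ)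
  · obtain ⟨φ, hφ, hp, hadapt⟩ := g.exists_isAdaptedChart hu htwist p
    exact ⟨φ, hφ, hp, hadapt, g.hasAdaptedForm_of_isAdaptedChart hd hφ hu hshear hadapt⟩
  · exact g.hasAdaptedForm_of_isAdaptedChart hd hφ hu hshear hadapt
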